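/- Let $(\mathcal M,g_{\mu\nu})$ be a smooth four-dimensional Lorentzian manifold of signature $(+,-,-,-)$ with Levi-Civita connection $\nabla$, satisfying the vacuum equations $R_{\mu\nu}=0$, and let $\xi^\mu$ be a smooth Killing vector field, $\nabla_\mu\xi_\nu+\nabla_\nu\xi_\mu=0$. The Riemann tensor is normalized by $(\nabla_\gamma\nabla_\delta-\nabla_\delta\nabla_\gamma)V^\alpha=R^\alpha{}_{\beta\gamma\delta}V^\beta$. Let $U\subset\mathcal M$ be open with a smooth spin frame over $U$, i.e. a smooth hermitian soldering form $\sigma^\mu{}_{AA'}$ on $U$ with $g_{\mu\nu}\sigma^\mu{}_{AA'}\sigma^\nu{}_{BB'}=\epsilon_{AB}\epsilon_{A'B'}$, and use it to convert tensor indices into spinor indices. Spinor indices are moved by $\kappa_B=\kappa^A\epsilon_{AB}$, $\kappa^A=\epsilon^{AB}\kappa_B$ with $\epsilon_{01}=\epsilon^{01}=1$ (and likewise for primed indices), and $\nabla_{AA'}$ also denotes the spin connection, the unique extension of $\nabla$ to spinors that annihilates $\epsilon_{AB}$ and $\sigma^\mu{}_{AA'}$. Let $$F_{\mu\nu}=\nabla_\mu\xi_\nu,\qquad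 \phi_{AB}=\tfrac12\nabla_{(A|B'|}\xi_{B)}{}^{B'},\qquad \Psi_{ABCD}=X_{(ABCD)},\quad X_{ABCD}=\tfrac14R_{AX'B}{}^{X'}{}_{CY'D}{}^{Y'}$$ ($\Psi_{ABCD}$ is the Weyl spinor). Let $\mathcal F_{\mu\nu}=F_{\mu\nu}+\tfrac{\mathrm i}{2}\eta_{\mu\nu}{}^{\rho\tau}F_{\rho\tau}$, where $\eta$ is the volume form with spinor form $$\eta_{AA'BB'CC'DD'}=\mathrm i(\epsilon_{AC}\epsilon_{BD}\epsilon_{A'D'}\epsilon_{B'C'}-\epsilon_{AD}\epsilon_{BC}\epsilon_{A'C'}\epsilon_{B'D'}).$$ Let $\sigma:U\to\mathbb C$ be an Ernst potential, i.e. a differentiable function with $\nabla_\alpha\sigma=2\mathcal F_{\alpha\beta}\xi^\beta$ on $U$. At the points of $U$ where $\sigma\neq0$ define the Mars–Simon spinor $$\mathcal S_{ABCD}=\Psi_{ABCD}+\frac{12}{\sigma}\,\phi_{(AB}\phi_{CD)} .$$ Then at every point of $U$ where $\sigma\ne0$ the field $\mathcal S_{ABCD}$ is differentiable and $$\nabla_{AA'}\mathcal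 S_{BCD}{}^{A}=\frac{12}{\sigma}\,\xi^{A}{}_{A'}\,\mathcal S_{FA(CD}\,\phi_{B)}{}^{F}.$$ -/

import Mathlib

open scoped Manifold ContDiff Bundle

noncomputable section

namespace MarsSimon

/-! ## Lorentzian four-manifolds -/

/-- The diagonal entries of the Minkowski metric of signature `(+,-,-,-)`. -/
def minkowski : Fin 4 → ℝ := ![1, -1, -1, -1]

/-- A smooth Lorentzian metric of signature `(+,-,-,-)` on a smooth four-manifold. -/
structure LorentzMetric (M : Type*) [TopologicalSpace M]
    [ChartedSpace (EuclideanSpace ℝ (Fin 4)) M] [IsManifold (𝓡 4) ∞ M] where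
  /-- The inner product on each tangent space. -/
  inner (p : M) : TangentSpace (𝓡 4) p →L[ℝ] TangentSpace (𝓡 4) p →L[ℝ] ℝ
  symm (p : M) (v w : TangentSpace (𝓡 4) p) : inner p v w = inner p w v
  signature (p : M) : ∃ b : Fin 4 → TangentSpace (𝓡 4) p,
    ∀ i j, inner p (b i) (b j) = if i = j then minkowski i else 0
  contMDiff : ContMDiff (𝓡 4)
    ((𝓡 4).prod 𝓘(ℝ, EuclideanSpace ℝ (Fin 4) →L[ℝ] EuclideanSpace ℝ (Fin 4) →L[ℝ] ℝ)) ∞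
    (fun p ↦ Bundle.TotalSpace.mk'
      (EuclideanSpace ℝ (Fin 4) →L[ℝ] EuclideanSpace ℝ (Fin 4) →L[ℝ] ℝ)
      (E := fun p : M ↦ TangentSpace (𝓡 4) p →L[ℝ] TangentSpace (𝓡 4) p →L[ℝ] ℝ) p (inner p))

/-- Connections on the tangent bundle of a four-manifold. `nabla Y p v` is `∇_v Y` at `p`. -/
abbrev TangentConnection (M : Type*) [TopologicalSpace M]
    [ChartedSpace (EuclideanSpace ℝ (Fin 4)) M] [IsManifold (𝓡 4) ∞ M] :=
  CovariantDerivative (𝓡 4) (EuclideanSpace ℝ (Fin 4)) (TangentSpace (𝓡 4) : M → Type)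

variable {M : Type*} [TopologicalSpace M] [ChartedSpace (EuclideanSpace ℝ (Fin 4)) M]
  [IsManifold (𝓡 4) ∞ M]

/-- `nabla` is the Levi-Civita connection of `g`: torsion-free and compatible with the metric. -/
structure IsLeviCivita (g : LorentzMetric M) (nabla : TangentConnection M) : Prop where
  torsion_eq_zero : nabla.torsion = 0
  metric (X Y : Π p : M, TangentSpace (𝓡 4) p) (p : M) (v : TangentSpace (𝓡 4) p) :
    MDifferentiableAt (𝓡 4) ((𝓡 4).prod 𝓘(ℝ, EuclideanSpace ℝ (Fin 4)))
      (fun q ↦ (⟨q, X q⟩ : TangentBundle (𝓡 4) M)) p →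
    MDifferentiableAt (𝓡 4) ((𝓡 4).prod 𝓘(ℝ, EuclideanSpace ℝ (Fin 4)))
      (fun q ↦ (⟨q, Y q⟩ : TangentBundle (𝓡 4) M)) p →
      mvfderiv (𝓡 4) (fun q ↦ g.inner q (X q) (Y q)) p v =
        g.inner p (nabla X p v) (Y p) + g.inner p (X p) (nabla Y p v)

/-- The curvature `R(X,Y)Z = ∇_X ∇_Y Z - ∇_Y ∇_X Z - ∇_{[X,Y]} Z` at `p`. -/
def curvature (nabla : TangentConnection M) (X Y Z : Π p : M, TangentSpace (𝓡 4) p) (p : M) :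
    TangentSpace (𝓡 4) p :=
  nabla (fun q ↦ nabla Z q (Y q)) p (X p) - nabla (fun q ↦ nabla Z q (X q)) p (Y p)
    - nabla Z p (VectorField.mlieBracket (𝓡 4) X Y p)

/-- The vector field `xi` is a Killing vector: `∇_μ ξ_ν + ∇_ν ξ_μ = 0`. -/
def IsKilling (g : LorentzMetric M) (nabla : TangentConnection M)
    (xi : Π p : M, TangentSpace (𝓡 4) p) : Prop :=
  ContMDiff (𝓡 4) ((𝓡 4).prod 𝓘(ℝ, EuclideanSpace ℝ (Fin 4))) ∞
      (fun q ↦ (⟨q, xi q⟩ : TangentBundle (𝓡 4) M)) ∧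
    ∀ (p : M) (v w : TangentSpace (𝓡 4) p),
      g.inner p (nabla xi p v) w + g.inner p (nabla xi p w) v = 0

/-- A smooth orthonormal tetrad `e_0, e_1, e_2, e_3` on `U`. -/
structure Tetrad (g : LorentzMetric M) (U : Set M) where
  /-- The four vector fields. -/
  vec : Fin 4 → Π p : M, TangentSpace (𝓡 4) p
  contMDiffOn (a : Fin 4) : ContMDiffOn (𝓡 4) ((𝓡 4).prod 𝓘(ℝ, EuclideanSpace ℝ (Fin 4))) ∞
    (fun q ↦ (⟨q, vec a q⟩ : TangentBundle (𝓡 4) M)) U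
  orthonormal (p : M) (hp : p ∈ U) (a b : Fin 4) :
    g.inner p (vec a p) (vec b p) = if a = b then minkowski a else 0

section Tensors

variable {g : LorentzMetric M} {U : Set M}

/-- Riemann components `R_{abcd} = g(e_a, R(e_c, e_d) e_b)`, that is, with the convention
`(∇_γ ∇_δ - ∇_δ ∇_γ) V^α = R^α{}_{βγδ} V^β`. -/
def riemann (nabla : TangentConnection M) (e : Tetrad g U) (a b c d : Fin 4) (p : M) : ℝ :=
  g.inner p (e.vec a p) (curvature nabla (e.vec c) (e.vec d) (e.vec b) p)

/-- Ricci components `R_{bd} = R^a{}_{bad}`. -/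
def ricci (nabla : TangentConnection M) (e : Tetrad g U) (b d : Fin 4) (p : M) : ℝ :=
  ∑ a, minkowski a * riemann nabla e a b a d p

end Tensors

/-- The vacuum Einstein equations `R_{μν} = 0` on all of `M`, expressed in all local orthonormal
tetrads (which exist around every point). -/
def IsVacuum (g : LorentzMetric M) (nabla : TangentConnection M) : Prop :=
  ∀ (U : Set M), IsOpen U → ∀ (e : Tetrad g U) (p : M), p ∈ U → ∀ b d, ricci nabla e b d p = 0

/-! ## Two-component spinor algebra

All spinor indices take values in `Fin 2`; a spinor is represented by its components in a spin
frame. Indices are moved with `κ_B = κ^A ε_{AB}`, `κ^A = ε^{AB} κ_B`, and likewise for primed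
indices. -/

/-- The components of each of `ε_{AB}`, `ε^{AB}`, `ε_{A'B'}` and `ε^{A'B'}` in a spin frame. -/
def eps (A B : Fin 2) : ℂ := !![0, 1; -1, 0] A B

/-- The total symmetrization `T_{(A_1 ... A_n)}`. -/
def symmetrize {n : ℕ} (T : (Fin n → Fin 2) → ℂ) (I : Fin n → Fin 2) : ℂ :=
  (1 / (n.factorial : ℂ)) * ∑ s : Equiv.Perm (Fin n), T (I ∘ s)

/-- The identity matrix and the three Pauli matrices. -/
def pauli : Fin 4 → Matrix (Fin 2) (Fin 2) ℂ :=
  ![!![1, 0; 0, 1], !![0, 1; 1, 0], !![0, -Complex.I; Complex.I, 0], !![1, 0; 0, -1]]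

/-- The Infeld-van der Waerden symbols `σ_a^{AA'}`: a vector `v = v^a e_a` has the spinor
components `v^{AA'} = v^a σ_a^{AA'}`. -/
def solderUp (a : Fin 4) (A A' : Fin 2) : ℂ := (1 / (Real.sqrt 2 : ℂ)) * pauli a A A'

/-- The inverse symbols `σ^a_{AA'}`: a covector `w` has the spinor components
`w_{AA'} = σ^a_{AA'} w(e_a)`. The soldering form is the field `σ^μ_{AA'} = σ^a_{AA'} e_a^μ`. -/
def solder (a : Fin 4) (A A' : Fin 2) : ℂ := (starRingEnd ℂ) (solderUp a A A')

/-- The soldering form is hermitian. -/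
theorem solder_hermitian (a : Fin 4) (A A' : Fin 2) :
    (starRingEnd ℂ) (solder a A A') = solder a A' A := by
  fin_cases a <;> fin_cases A <;> fin_cases A' <;> simp [solder, solderUp, pauli]

theorem sqrt_two_inv_sq : ((Real.sqrt 2 : ℂ))⁻¹ * ((Real.sqrt 2 : ℂ))⁻¹ = 1 / 2 := by
  rw [← mul_inv, ← Complex.ofReal_mul, Real.mul_self_sqrt (by norm_num)]
  norm_num

/-- The soldering form is normalized by `g_{μν} σ^μ_{AA'} σ^ν_{BB'} = ε_{AB} ε_{A'B'}`. -/
theorem solder_metric (A A' B B' : Fin 2) :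
    ∑ a, (minkowski a : ℂ) * (solder a A A' * solder a B B') = eps A B * eps A' B' := by
  have h := sqrt_two_inv_sq
  have hI := Complex.I_mul_I
  fin_cases A <;> fin_cases A' <;> fin_cases B <;> fin_cases B' <;>
    simp [Fin.sum_univ_four, solder, solderUp, pauli, minkowski, eps] <;> grind

/-- `σ^a_{AA'}` is inverse to `σ_a^{AA'}`. -/
theorem solder_mul_solderUp (a b : Fin 4) :
    ∑ A, ∑ A', solder a A A' * solderUp b A A' = if a = b then 1 else 0 := by
  have h := sqrt_two_inv_sq
  have hI := Complex.I_mul_I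
  fin_cases a <;> fin_cases b <;>
    simp [Fin.sum_univ_two, solder, solderUp, pauli] <;> grind

/-- The volume form in spinor form,
`η_{AA'BB'CC'DD'} = i (ε_{AC} ε_{BD} ε_{A'D'} ε_{B'C'} - ε_{AD} ε_{BC} ε_{A'C'} ε_{B'D'})`. -/
def volumeSpinor (A A' B B' C C' D D' : Fin 2) : ℂ :=
  Complex.I * (eps A C * eps B D * eps A' D' * eps B' C'
    - eps A D * eps B C * eps A' C' * eps B' D')

/-! ## Spinor fields on a space-time

A spin frame on an open set `U` is given through its orthonormal tetrad `e`; the soldering form is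
`σ^μ_{AA'} = σ^a_{AA'} e_a^μ`. -/

section Spinors

variable {g : LorentzMetric M} {U : Set M}

/-- Connection coefficients `ω_{ab}{}^c` of the tetrad, `∇_{e_a} e_b = ω_{ab}{}^c e_c`. -/
def connCoeff (nabla : TangentConnection M) (e : Tetrad g U) (a b c : Fin 4) (p : M) : ℝ :=
  minkowski c * g.inner p (nabla (e.vec b) p (e.vec a p)) (e.vec c p)

/-- Coefficients `γ_{aA}{}^B = (1/2) σ_ν^{BX'} ∇_a σ^ν_{AX'}` of the spin connection, the unique
`γ` with `γ_{aA}{}^A = 0` (that is, `∇ ε = 0`) and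
`∇_a σ^ν_{AA'} - γ_{aA}{}^B σ^ν_{BA'} - conj(γ)_{aA'}{}^{B'} σ^ν_{AB'} = 0`. -/
def spinCoeff (nabla : TangentConnection M) (e : Tetrad g U) (a : Fin 4) (A B : Fin 2) (p : M) :
    ℂ :=
  (1 / 2) * ∑ b, ∑ c, ∑ X', solderUp c B X' * solder b A X' * (connCoeff nabla e a b c p : ℂ)

/-- Compatibility with the metric makes `ω_{abc}` skew in `b, c`. -/
theorem connCoeff_skew {nabla : TangentConnection M} (hnabla : IsLeviCivita g nabla)
    (hU : IsOpen U) (e : Tetrad g U) {p : M} (hp : p ∈ U) (a b c : Fin 4) :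
    minkowski c * connCoeff nabla e a b c p + minkowski b * connCoeff nabla e a c b p = 0 := by
  have hd (i : Fin 4) := ((e.contMDiffOn i).contMDiffAt (hU.mem_nhds hp)).mdifferentiableAt
    (by simp)
  have h := hnabla.metric (e.vec b) (e.vec c) p (e.vec a p) (hd b) (hd c)
  have hc : (fun q ↦ g.inner q (e.vec b q) (e.vec c q)) =ᶠ[nhds p]
      fun _ ↦ if b = c then minkowski b else 0 := by
    filter_upwards [hU.mem_nhds hp] with q hq using e.orthonormal q hq b c
  have h0 : mvfderiv (𝓡 4) (fun q ↦ g.inner q (e.vec b q) (e.vec c q)) p (e.vec a p) = 0 := by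
    have hm : mfderiv (𝓡 4) 𝓘(ℝ, ℝ) (fun q ↦ g.inner q (e.vec b q) (e.vec c q)) p = 0 :=
      hc.mfderiv_eq.trans mfderiv_const
    simp only [mvfderiv, ContinuousLinearMap.comp_apply, hm]
    exact map_zero _
  rw [h0, g.symm p (e.vec b p)] at h
  have hm (i : Fin 4) : minkowski i * minkowski i = 1 := by fin_cases i <;> simp [minkowski]
  simp only [connCoeff, ← mul_assoc, hm, one_mul]
  exact h.symm

/-- The spin connection preserves `ε`: its coefficients are trace-free. -/
theorem spinCoeff_trace {nabla : TangentConnection M} (hnabla : IsLeviCivita g nabla)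
    (hU : IsOpen U) (e : Tetrad g U) {p : M} (hp : p ∈ U) (a : Fin 4) :
    ∑ A, spinCoeff nabla e a A A p = 0 := by
  have hs (b c : Fin 4) := connCoeff_skew hnabla hU e hp a b c
  have h00 := hs 0 0; have h11 := hs 1 1; have h22 := hs 2 2; have h33 := hs 3 3
  simp only [minkowski] at h00 h11 h22 h33
  have e0 : connCoeff nabla e a 0 0 p = 0 := by simp at h00; linarith
  have e1 : connCoeff nabla e a 1 1 p = 0 := by simp at h11; linarith
  have e2 : connCoeff nabla e a 2 2 p = 0 := by simp at h22; linarith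
  have e3 : connCoeff nabla e a 3 3 p = 0 := by simp at h33; linarith
  have key : ∑ A, spinCoeff nabla e a A A p =
      (1 / 2) * ∑ b, ∑ c, (∑ A, ∑ X', solder b A X' * solderUp c A X') *
        (connCoeff nabla e a b c p : ℂ) := by
    simp only [spinCoeff, Fin.sum_univ_four, Fin.sum_univ_two]
    ring
  rw [key]
  simp only [solder_mul_solderUp, Fin.sum_univ_four]
  simp [e0, e1, e2, e3]

set_option maxHeartbeats 400000 in
/-- The spin connection is compatible with the soldering form: `∇_a σ^c_{AA'} = 0`. -/
theorem spinCoeff_solder {nabla : TangentConnection M} (hnabla : IsLeviCivita g nabla)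
    (hU : IsOpen U) (e : Tetrad g U) {p : M} (hp : p ∈ U) (a c : Fin 4) (A A' : Fin 2) :
    ∑ b, solder b A A' * (connCoeff nabla e a b c p : ℂ)
      - ∑ B, spinCoeff nabla e a A B p * solder c B A'
      - ∑ B', (starRingEnd ℂ) (spinCoeff nabla e a A' B' p) * solder c A B' = 0 := by
  have hs (b c : Fin 4) := connCoeff_skew hnabla hU e hp a b c
  have h00 := hs 0 0; have h11 := hs 1 1; have h22 := hs 2 2; have h33 := hs 3 3
  have h01 := hs 1 0; have h02 := hs 2 0; have h03 := hs 3 0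
  have h12 := hs 2 1; have h13 := hs 3 1; have h23 := hs 3 2
  simp only [minkowski] at h00 h11 h22 h33 h01 h02 h03 h12 h13 h23
  have e0 : connCoeff nabla e a 0 0 p = 0 := by simp at h00; linarith
  have e1 : connCoeff nabla e a 1 1 p = 0 := by simp at h11; linarith
  have e2 : connCoeff nabla e a 2 2 p = 0 := by simp at h22; linarith
  have e3 : connCoeff nabla e a 3 3 p = 0 := by simp at h33; linarith
  have e01 : connCoeff nabla e a 1 0 p = connCoeff nabla e a 0 1 p := by simp at h01; linarith
  have e02 : connCoeff nabla e a 2 0 p = connCoeff nabla e a 0 2 p := by simp at h02; linarith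
  have e03 : connCoeff nabla e a 3 0 p = connCoeff nabla e a 0 3 p := by simp at h03; linarith
  have e12 : connCoeff nabla e a 2 1 p = -connCoeff nabla e a 1 2 p := by simp at h12; linarith
  have e13 : connCoeff nabla e a 3 1 p = -connCoeff nabla e a 1 3 p := by simp at h13; linarith
  have e23 : connCoeff nabla e a 3 2 p = -connCoeff nabla e a 2 3 p := by simp at h23; linarith
  have h := sqrt_two_inv_sq
  have hI := Complex.I_mul_I
  generalize hr : ((Real.sqrt 2 : ℂ))⁻¹ = r at h
  have hrc : (starRingEnd ℂ) r = r := by rw [← hr]; simp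
  have h2 : (starRingEnd ℂ) 2 = 2 := map_ofNat _ 2
  clear hs h00 h11 h22 h33 h01 h02 h03 h12 h13 h23
  have hexp (A B : Fin 2) : spinCoeff nabla e a A B p =
      (1 / 4) * ∑ b, ∑ c, (∑ X', pauli c B X' * (starRingEnd ℂ) (pauli b A X')) *
        (connCoeff nabla e a b c p : ℂ) := by
    have hr' : 1 / (Real.sqrt 2 : ℂ) = r := by rw [← hr, one_div]
    simp only [spinCoeff, solder, solderUp, hr', map_mul, hrc, Finset.mul_sum, Finset.sum_mul]
    refine Finset.sum_congr rfl fun b _ ↦ Finset.sum_congr rfl fun c _ ↦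
      Finset.sum_congr rfl fun X _ ↦ ?_
    linear_combination (1 / 2) * pauli c B X * (starRingEnd ℂ) (pauli b A X) *
      (connCoeff nabla e a b c p : ℂ) * h
  have g00 : spinCoeff nabla e a 0 0 p =
      ((connCoeff nabla e a 0 3 p : ℂ) - Complex.I * connCoeff nabla e a 1 2 p) / 2 := by
    rw [hexp]
    simp [Fin.sum_univ_four, pauli, e0, e1, e2, e3, e03, e12]
    ring_nf
  have g11 : spinCoeff nabla e a 1 1 p =
      -((connCoeff nabla e a 0 3 p : ℂ) - Complex.I * connCoeff nabla e a 1 2 p) / 2 := by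
    rw [hexp]
    simp [Fin.sum_univ_four, pauli, e0, e1, e2, e3, e03, e12]
    ring_nf
  have g01 : spinCoeff nabla e a 0 1 p =
      ((connCoeff nabla e a 0 1 p : ℂ) + Complex.I * connCoeff nabla e a 0 2 p
        - connCoeff nabla e a 1 3 p - Complex.I * connCoeff nabla e a 2 3 p) / 2 := by
    rw [hexp]
    simp [Fin.sum_univ_four, pauli, e01, e02, e13, e23]
    ring_nf
  have g10 : spinCoeff nabla e a 1 0 p =
      ((connCoeff nabla e a 0 1 p : ℂ) - Complex.I * connCoeff nabla e a 0 2 p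
        + connCoeff nabla e a 1 3 p - Complex.I * connCoeff nabla e a 2 3 p) / 2 := by
    rw [hexp]
    simp [Fin.sum_univ_four, pauli, e01, e02, e13, e23]
    ring_nf
  clear hexp
  fin_cases c <;> fin_cases A <;> fin_cases A' <;>
    simp [Fin.sum_univ_four, Fin.sum_univ_two, solder, solderUp, pauli, hr, hrc, h2,
      g00, g01, g10, g11, e0, e1, e2, e3, e01, e02, e03, e12, e13, e23] <;>
    ring_nf <;> simp only [Complex.I_sq] <;> ring_nf

/-- The gradient `∇_{AA'} f = σ^μ_{AA'} ∂_μ f` of a complex function. -/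
def gradient (e : Tetrad g U) (f : M → ℂ) (A A' : Fin 2) (p : M) : ℂ :=
  ∑ a, solder a A A' * mvfderiv (𝓡 4) f p (e.vec a p)

/-- The spinor covariant derivative
`∇_{AA'} T_{I_1 ... I_n} = σ^a_{AA'} (e_a(T_{I_1 ... I_n}) - ∑_k γ_{a I_k}{}^B T_{I_1 .. B .. I_n})`
of a spinor field with `n` unprimed lower indices. -/
def covDeriv (nabla : TangentConnection M) (e : Tetrad g U) {n : ℕ}
    (T : (Fin n → Fin 2) → M → ℂ) (A A' : Fin 2) (I : Fin n → Fin 2) (p : M) : ℂ :=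
  gradient e (T I) A A' p
    - ∑ a, solder a A A' *
        ∑ k, ∑ B, spinCoeff nabla e a (I k) B p * T (Function.update I k B) p

/-- The Killing spinor components `ξ_{AA'}`. -/
def killingVec (e : Tetrad g U) (xi : Π p : M, TangentSpace (𝓡 4) p) (A A' : Fin 2) (p : M) : ℂ :=
  ∑ a, solder a A A' * (g.inner p (e.vec a p) (xi p) : ℂ)

/-- `ξ^A{}_{A'} = ε^{AB} ξ_{BA'}`. -/
def killingVecMixed (e : Tetrad g U) (xi : Π p : M, TangentSpace (𝓡 4) p) (A A' : Fin 2) (p : M) :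
    ℂ :=
  ∑ B, eps A B * killingVec e xi B A' p

/-- `ξ^{AA'} = ε^{AB} ε^{A'B'} ξ_{BB'}`. -/
def killingVecUp (e : Tetrad g U) (xi : Π p : M, TangentSpace (𝓡 4) p) (A A' : Fin 2) (p : M) :
    ℂ :=
  ∑ B, ∑ B', eps A B * eps A' B' * killingVec e xi B B' p

/-- The Killing 2-form `F_{μν} = ∇_μ ξ_ν` in spinor form, `F_{AA'BB'}`. -/
def killingForm (nabla : TangentConnection M) (e : Tetrad g U)
    (xi : Π p : M, TangentSpace (𝓡 4) p) (A A' B B' : Fin 2) (p : M) : ℂ :=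
  ∑ a, ∑ b, solder a A A' * solder b B B' *
    (g.inner p (nabla xi p (e.vec a p)) (e.vec b p) : ℂ)

/-- The symmetric spinor `φ_{AB} = (1/2) ∇_{(A|B'|} ξ_{B)}{}^{B'} = (1/2) F_{(A|B'|B)}{}^{B'}` of
the Killing 2-form. -/
def phi (nabla : TangentConnection M) (e : Tetrad g U) (xi : Π p : M, TangentSpace (𝓡 4) p)
    (A B : Fin 2) (p : M) : ℂ :=
  symmetrize (fun J : Fin 2 → Fin 2 ↦
    (1 / 2) * ∑ X', ∑ Y', eps X' Y' * killingForm nabla e xi (J 0) X' (J 1) Y' p) ![A, B]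

/-- `φ_B{}^F = ε^{FG} φ_{BG}`. -/
def phiMixed (nabla : TangentConnection M) (e : Tetrad g U) (xi : Π p : M, TangentSpace (𝓡 4) p)
    (B F : Fin 2) (p : M) : ℂ :=
  ∑ G, eps F G * phi nabla e xi B G p

/-- The self-dual Killing 2-form `𝓕 = F + i F*`, `F*_{ab} = (1/2) η_{ab}{}^{cd} F_{cd}`, in spinor
form. -/
def selfDualForm (nabla : TangentConnection M) (e : Tetrad g U)
    (xi : Π p : M, TangentSpace (𝓡 4) p) (A A' B B' : Fin 2) (p : M) : ℂ :=
  killingForm nabla e xi A A' B B' p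
    + Complex.I * ((1 / 2) * ∑ C, ∑ C', ∑ D, ∑ D', volumeSpinor A A' B B' C C' D D' *
        ∑ P, ∑ P', ∑ Q, ∑ Q', eps C P * eps C' P' * eps D Q * eps D' Q' *
          killingForm nabla e xi P P' Q Q' p)

/-- The Ernst 1-form `σ_α = 2 𝓕_{αβ} ξ^β` in spinor form. -/
def ernstForm (nabla : TangentConnection M) (e : Tetrad g U)
    (xi : Π p : M, TangentSpace (𝓡 4) p) (A A' : Fin 2) (p : M) : ℂ :=
  2 * ∑ B, ∑ B', selfDualForm nabla e xi A A' B B' p * killingVecUp e xi B B' p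

/-- `sigma` is an Ernst potential on `U`: it is differentiable there and `∇_α σ = σ_α`. -/
def IsErnstPotential (nabla : TangentConnection M) (e : Tetrad g U)
    (xi : Π p : M, TangentSpace (𝓡 4) p) (sigma : M → ℂ) : Prop :=
  ∀ p ∈ U, MDifferentiableAt (𝓡 4) 𝓘(ℝ, ℂ) sigma p ∧
    ∀ A A', gradient e sigma A A' p = ernstForm nabla e xi A A' p

/-- The Riemann tensor in spinor form, `R_{AA'BB'CC'DD'}`. -/
def riemannSpinor (nabla : TangentConnection M) (e : Tetrad g U)
    (A A' B B' C C' D D' : Fin 2) (p : M) : ℂ :=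
  ∑ a, ∑ b, ∑ c, ∑ d, solder a A A' * solder b B B' * solder c C C' * solder d D D' *
    (riemann nabla e a b c d p : ℂ)

/-- The curvature spinor `X_{ABCD} = (1/4) R_{AX'B}{}^{X'}{}_{CY'D}{}^{Y'}`. -/
def curvatureSpinor (nabla : TangentConnection M) (e : Tetrad g U)
    (I : Fin 4 → Fin 2) (p : M) : ℂ :=
  (1 / 4) * ∑ X', ∑ Z', ∑ Y', ∑ W', eps X' Z' * eps Y' W' *
    riemannSpinor nabla e (I 0) X' (I 1) Z' (I 2) Y' (I 3) W' p

/-- The Weyl spinor `Ψ_{ABCD} = X_{(ABCD)}`. -/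
def weylSpinor (nabla : TangentConnection M) (e : Tetrad g U) (I : Fin 4 → Fin 2) (p : M) : ℂ :=
  symmetrize (fun J ↦ curvatureSpinor nabla e J p) I

/-- The Mars-Simon spinor `S_{ABCD} = Ψ_{ABCD} + (12/σ) φ_{(AB} φ_{CD)}`. -/
def marsSimonSpinor (nabla : TangentConnection M) (e : Tetrad g U)
    (xi : Π p : M, TangentSpace (𝓡 4) p) (sigma : M → ℂ) (I : Fin 4 → Fin 2) (p : M) : ℂ :=
  weylSpinor nabla e I p + (12 / sigma p) *
    symmetrize (fun J ↦ phi nabla e xi (J 0) (J 1) p * phi nabla e xi (J 2) (J 3) p) I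

end Spinors

end MarsSimon

end

/-! The identity rests on three differential facts. In vacuum the curvature spinor X_{ABCD} is
totally symmetric, so it equals Ψ_{ABCD}, and the Bianchi identity makes Ψ divergence-free. A
Killing field satisfies ∇_a∇_bξ_c = R_{dabc}ξ^d, and the unprimed part of this equation is
∇_{AA'}φ_{BC} = Ψ_{ABCD}ξ^D{}_{A'}. Finally 𝓕_{AA'BB'} = 2φ_{AB}ε_{A'B'}, so ∇_{AA'}σ =
−4φ_{AB}ξ^B{}_{A'}.

The Leibniz rule then turns the divergence of the Mars–Simon spinor into an algebraic expression in
Ψ, φ, ξ and 1/σ. A term in which the derivative index is contracted with an index of the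
differentiated φ vanishes by the symmetry of Ψ. What remains is the right-hand side, by a polynomial
identity in components (`marsSimon_algebra`).

The tensor facts are obtained as identities in a commutative ℝ-algebra: functions smooth on `U` form
the algebra, the frame vectors act as derivations, and the connection coefficients are elements.
Skew coefficients, the frame commutator and the algebraic Bianchi identity then suffice
(`frameCurvature_bianchi`, `frameCov₂_killing`). The commutator and the algebraic Bianchi identity
come from the Jacobi identity for Lie brackets, and smoothness of the coefficients from the Koszul
formula.

The passage to spinors is equivariance: a skew matrix acts on the self-dual part of a two-form
through its spin matrix (`selfDual_action`), so the spin connection differentiates the spinor of a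
tensor as the Levi-Civita connection differentiates the tensor. Ricci-flatness makes the contracted
curvature self-dual (`IsWeyl.isSelfDual`), and for such forms closed implies divergence-free
(`divergence_selfDual`). -/

noncomputable section

namespace MarsSimon

/-! ### Tensor calculus in an orthonormal frame over a commutative ring -/

section Frame

variable {R : Type*} [CommRing R] (eta : Fin 4 → R) (D : Fin 4 → R → R)
  (L : Fin 4 → Fin 4 → Fin 4 → R)

/-- Curvature of the connection with coefficients `L` in an orthonormal frame. -/
def frameCurvature (a b c d : Fin 4) : R :=
  D c (L d b a) - D d (L c b a) +
    ∑ f, eta f * (L d b f * L c f a - L c b f * L d f a - (L c d f - L d c f) * L f b a)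

/-- Covariant derivative of a covector field in an orthonormal frame. -/
def frameCov₁ (X : Fin 4 → R) (a b : Fin 4) : R :=
  D a (X b) - ∑ c, eta c * (L a b c * X c)

/-- Covariant derivative of a tensor field of valence two in an orthonormal frame. -/
def frameCov₂ (T : Fin 4 → Fin 4 → R) (a b c : Fin 4) : R :=
  D a (T b c) - ∑ f, eta f * (L a b f * T f c + L a c f * T b f)

/-- Covariant derivative of a tensor field of valence four in an orthonormal frame. -/
def frameCov₄ (T : Fin 4 → Fin 4 → Fin 4 → Fin 4 → R) (e a b c d : Fin 4) : R :=
  D e (T a b c d) - ∑ f, eta f * (L e a f * T f b c d + L e b f * T a f c d +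
    L e c f * T a b f d + L e d f * T a b c f)

end Frame

/-! ### Ricci, Bianchi and Killing identities in a frame -/

section FrameIdentities

variable {R : Type*} [CommRing R] [Algebra ℝ R] {eta : Fin 4 → R} {D : Fin 4 → Derivation ℝ R R}
  {L : Fin 4 → Fin 4 → Fin 4 → R}

/-- Antisymmetry of the connection coefficients in concrete frame indices. -/
theorem skew_concrete (hskew : ∀ a b c, L a b c + L a c b = 0) (a : Fin 4) :
    (L a 0 0 = 0 ∧ L a 1 1 = 0 ∧ L a 2 2 = 0 ∧ L a 3 3 = 0) ∧
    (L a 1 0 = - L a 0 1 ∧ L a 2 0 = - L a 0 2 ∧ L a 3 0 = - L a 0 3) ∧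
    (L a 2 1 = - L a 1 2 ∧ L a 3 1 = - L a 1 3 ∧ L a 3 2 = - L a 2 3) := by
  have hd (b : Fin 4) : L a b b = 0 := by
    have h : (2 : ℝ) • L a b b = 0 := by rw [two_smul, hskew]
    exact (smul_eq_zero_iff_right two_ne_zero).1 h
  have ho (b c : Fin 4) : L a b c = - L a c b := by linear_combination hskew a b c
  exact ⟨⟨hd 0, hd 1, hd 2, hd 3⟩, ⟨ho _ _, ho _ _, ho _ _⟩, ho _ _, ho _ _, ho _ _⟩

/-- The Ricci identity for a covector field. -/
theorem frameCov₂_commutator (heta : ∀ a b, D a (eta b) = 0)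
    (hskew : ∀ a b c, L a b c + L a c b = 0)
    (hcomm : ∀ a b f, D a (D b f) - D b (D a f) = ∑ c, eta c * ((L a b c - L b a c) * D c f))
    (X : Fin 4 → R) (a b c : Fin 4) :
    frameCov₂ eta (fun a ↦ D a) L (frameCov₁ eta (fun a ↦ D a) L X) a b c
      - frameCov₂ eta (fun a ↦ D a) L (frameCov₁ eta (fun a ↦ D a) L X) b a c =
      ∑ d, eta d * (X d * frameCurvature eta (fun a ↦ D a) L c d a b) := by
  have h := hcomm a b (X c)
  have hs (x y) : L x y c = - L x c y := by linear_combination hskew x y c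
  -- Once every coefficient is written through those with increasing last two indices, the terms
  -- quadratic in `L` cancel formally. The only second derivatives left are those of `h`.
  obtain ⟨⟨a1, a2, a3, a4⟩, ⟨a5, a6, a7⟩, a8, a9, a10⟩ := skew_concrete hskew a
  obtain ⟨⟨b1, b2, b3, b4⟩, ⟨b5, b6, b7⟩, b8, b9, b10⟩ := skew_concrete hskew b
  simp only [frameCov₂, frameCov₁, frameCurvature, map_sub, map_add, Derivation.leibniz, heta,
      smul_eq_mul, Fin.sum_univ_four, hs, map_neg] at h ⊢
  simp only [a1, a2, a3, a4, a5, a6, a7, a8, a9, a10, b1, b2, b3, b4, b5, b6, b7, b8, b9, b10]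
  linear_combination h

set_option maxHeartbeats 4000000 in
set_option maxRecDepth 20000 in
/-- The differential Bianchi identity. -/
theorem frameCurvature_bianchi (heta : ∀ a b, D a (eta b) = 0)
    (hskew : ∀ a b c, L a b c + L a c b = 0)
    (hcomm : ∀ a b f, D a (D b f) - D b (D a f) = ∑ c, eta c * ((L a b c - L b a c) * D c f))
    (hfirst : ∀ a b c d, frameCurvature eta (fun a ↦ D a) L a b c d +
      frameCurvature eta (fun a ↦ D a) L a c d b + frameCurvature eta (fun a ↦ D a) L a d b c = 0)
    (e a b c d : Fin 4) :
    frameCov₄ eta (fun a ↦ D a) L (frameCurvature eta (fun a ↦ D a) L) e a b c d +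
    frameCov₄ eta (fun a ↦ D a) L (frameCurvature eta (fun a ↦ D a) L) c a b d e +
    frameCov₄ eta (fun a ↦ D a) L (frameCurvature eta (fun a ↦ D a) L) d a b e c = 0 := by
  have h1 := hcomm e c (L d b a)
  have h2 := hcomm c d (L e b a)
  have h3 := hcomm d e (L c b a)
  have ho (x y z) : L x y z = - L x z y := by linear_combination hskew x y z
  obtain ⟨⟨c1, c2, c3, c4⟩, ⟨c5, c6, c7⟩, c8, c9, c10⟩ := skew_concrete hskew c
  obtain ⟨⟨d1, d2, d3, d4⟩, ⟨d5, d6, d7⟩, d8, d9, d10⟩ := skew_concrete hskew d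
  obtain ⟨⟨e1, e2, e3, e4⟩, ⟨e5, e6, e7⟩, e8, e9, e10⟩ := skew_concrete hskew e
  -- The derivatives of the structure functions `L c d f - L d c f` appear multiplied by `L f b a`.
  -- Their cyclic sum over `e`, `c`, `d` is the derivative part of the algebraic Bianchi identity
  -- with first index `f`.
  have j0 := hfirst 0 e c d
  have j1 := hfirst 1 e c d
  have j2 := hfirst 2 e c d
  have j3 := hfirst 3 e c d
  simp only [frameCov₄, frameCurvature, map_sub, map_add, Derivation.leibniz, heta,
      smul_eq_mul, Fin.sum_univ_four] at h1 h2 h3 j0 j1 j2 j3 ⊢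
  simp only [c1, c2, c3, c4, c5, c6, c7, c8, c9, c10, d1, d2, d3, d4, d5, d6, d7, d8, d9, d10,
    e1, e2, e3, e4, e5, e6, e7, e8, e9, e10] at j0 j1 j2 j3 ⊢
  simp only [ho _ 0 a, ho _ 1 a, ho _ 2 a, ho _ 3 a]
  linear_combination h1 + h2 + h3 - eta 0 * L 0 b a * j0 - eta 1 * L 1 b a * j1 -
    eta 2 * L 2 b a * j2 - eta 3 * L 3 b a * j3

/-- A Killing vector field satisfies `∇_a ∇_b X_c = R_{dabc} X^d`. -/
theorem frameCov₂_killing (heta : ∀ a b, D a (eta b) = 0)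
    (hskew : ∀ a b c, L a b c + L a c b = 0)
    (hcomm : ∀ a b f, D a (D b f) - D b (D a f) = ∑ c, eta c * ((L a b c - L b a c) * D c f))
    (hfirst : ∀ a b c d, frameCurvature eta (fun a ↦ D a) L a b c d +
      frameCurvature eta (fun a ↦ D a) L a c d b + frameCurvature eta (fun a ↦ D a) L a d b c = 0)
    (hR : ∀ a b c d, frameCurvature eta (fun a ↦ D a) L a b c d +
      frameCurvature eta (fun a ↦ D a) L b a c d = 0)
    (X : Fin 4 → R)
    (hX : ∀ a b, frameCov₁ eta (fun a ↦ D a) L X a b + frameCov₁ eta (fun a ↦ D a) L X b a = 0)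
    (a b c : Fin 4) :
    frameCov₂ eta (fun a ↦ D a) L (frameCov₁ eta (fun a ↦ D a) L X) a b c =
      ∑ d, eta d * (X d * frameCurvature eta (fun a ↦ D a) L d a b c) := by
  have ricci := frameCov₂_commutator heta hskew hcomm X
  set F := frameCov₁ eta (fun a ↦ D a) L X with hF
  set K := frameCurvature eta (fun a ↦ D a) L with hK
  have hskewF (a b c : Fin 4) : frameCov₂ eta (fun a ↦ D a) L F a b c +
      frameCov₂ eta (fun a ↦ D a) L F a c b = 0 := by
    have h (b c : Fin 4) : F b c = - F c b := by linear_combination hX b c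
    have h0 : D a (F b c) + D a (F c b) = 0 := by rw [← map_add, hX, map_zero]
    simp only [frameCov₂, Fin.sum_univ_four, h 0 b, h 0 c, h 1 b, h 1 c, h 2 b, h 2 c, h 3 b, h 3 c]
    linear_combination h0
  -- Skewness in the first pair brings `d` to the front in all three terms; the cyclic identity then
  -- merges two of them into a second copy of `K d a b c`.
  have hd (d : Fin 4) : K c d a b - K a d b c + K b d c a = 2 * K d a b c := by
    linear_combination hR c d a b - hR a d b c + hR b d c a - hfirst d a b c
  have hsum : ∑ d, eta d * (X d * K c d a b) - ∑ d, eta d * (X d * K a d b c) +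
      ∑ d, eta d * (X d * K b d c a) = 2 * ∑ d, eta d * (X d * K d a b c) := by
    rw [← Finset.sum_sub_distrib, ← Finset.sum_add_distrib, Finset.mul_sum]
    exact Finset.sum_congr rfl fun d _ ↦ by linear_combination eta d * X d * hd d
  -- As in the Koszul formula: in the alternating sum of three Ricci identities the skewness of ∇F
  -- cancels four of the six terms and doubles ∇_aF_{bc}.
  have key : (2 : ℝ) • (frameCov₂ eta (fun a ↦ D a) L F a b c) =
      (2 : ℝ) • ∑ d, eta d * (X d * K d a b c) := by
    rw [two_smul, two_smul]
    linear_combination ricci a b c - ricci b c a + ricci c a b + hskewF b a c - hskewF c a b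
      + hskewF a b c + hsum
  exact smul_right_injective R (two_ne_zero (α := ℝ)) key

end FrameIdentities

/-! ### Two-forms and their unprimed spinors -/

section SpinorAlgebra

/-- The spinor `F_{AB} = (1/2) ε^{X'Y'} F_{AX'BY'}` of a tensor of valence two. -/
def selfDual (F : Fin 4 → Fin 4 → ℂ) (A B : Fin 2) : ℂ :=
  (1 / 2) * ∑ X', ∑ Y', eps X' Y' * ∑ a, ∑ b, solder a A X' * solder b B Y' * F a b

/-- The spin connection coefficients belonging to the lowered coefficients `l` of a metric
connection. -/
def spinOf (l : Fin 4 → Fin 4 → ℂ) (A B : Fin 2) : ℂ :=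
  (1 / 2) * ∑ b, ∑ c, ∑ X', solderUp c B X' * solder b A X' * ((minkowski c : ℂ) * l b c)

theorem solder_values (A A' : Fin 2) :
    solder 0 A A' = ((Real.sqrt 2 : ℂ))⁻¹ * !![1, 0; 0, 1] A A' ∧
    solder 1 A A' = ((Real.sqrt 2 : ℂ))⁻¹ * !![0, 1; 1, 0] A A' ∧
    solder 2 A A' = ((Real.sqrt 2 : ℂ))⁻¹ * !![0, Complex.I; -Complex.I, 0] A A' ∧
    solder 3 A A' = ((Real.sqrt 2 : ℂ))⁻¹ * !![1, 0; 0, -1] A A' := by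
  fin_cases A <;> fin_cases A' <;> simp [solder, solderUp, pauli]

theorem skew_values {F : Fin 4 → Fin 4 → ℂ} (hF : ∀ a b, F a b + F b a = 0) :
    (F 0 0 = 0 ∧ F 1 1 = 0 ∧ F 2 2 = 0 ∧ F 3 3 = 0) ∧
    (F 1 0 = - F 0 1 ∧ F 2 0 = - F 0 2 ∧ F 3 0 = - F 0 3) ∧
    (F 2 1 = - F 1 2 ∧ F 3 1 = - F 1 3 ∧ F 3 2 = - F 2 3) := by
  have hd (b : Fin 4) : F b b = 0 := by linear_combination (1 / 2 : ℂ) * hF b b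
  have ho (b c : Fin 4) : F b c = - F c b := by linear_combination hF b c
  exact ⟨⟨hd 0, hd 1, hd 2, hd 3⟩, ⟨ho _ _, ho _ _, ho _ _⟩, ho _ _, ho _ _, ho _ _⟩

/-- Only the combinations F₀₁ − iF₂₃, F₀₂ + iF₁₃ and F₀₃ − iF₁₂ enter, that is, the self-dual part
in the sense of `IsSelfDual`. The spinor identities below are checked on these components. -/
theorem selfDual_skew {F : Fin 4 → Fin 4 → ℂ} (hF : ∀ a b, F a b + F b a = 0) (A B : Fin 2) :
    selfDual F A B = (1 / 2) * !![F 0 1 + Complex.I * F 0 2 - F 1 3 - Complex.I * F 2 3,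
      Complex.I * F 1 2 - F 0 3; Complex.I * F 1 2 - F 0 3,
      Complex.I * F 0 2 - F 0 1 - F 1 3 + Complex.I * F 2 3] A B := by
  obtain ⟨⟨h1, h2, h3, h4⟩, ⟨h5, h6, h7⟩, h8, h9, h10⟩ := skew_values hF
  have h := sqrt_two_inv_sq
  have hI := Complex.I_mul_I
  fin_cases A <;> fin_cases B <;>
    simp [selfDual, Fin.sum_univ_four, solder_values, eps, h1, h2, h3, h4, h5, h6, h7, h8, h9,
      h10] <;> grind

theorem selfDual_symm {F : Fin 4 → Fin 4 → ℂ} (hF : ∀ a b, F a b + F b a = 0) (A B : Fin 2) :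
    selfDual F A B = selfDual F B A := by
  rw [selfDual_skew hF, selfDual_skew hF]
  fin_cases A <;> fin_cases B <;> rfl

theorem solderUp_eq (a : Fin 4) (A A' : Fin 2) :
    solderUp a A A' = starRingEnd ℂ (solder a A A') := by simp [solder]

/-- The spin matrix is the self-dual spinor of `l` with its second index raised by ε^{BC}. This is
the infinitesimal form of the covering of the Lorentz group by SL(2,ℂ). -/
theorem spinOf_skew {l : Fin 4 → Fin 4 → ℂ} (hl : ∀ a b, l a b + l b a = 0) (A B : Fin 2) :
    spinOf l A B = ![selfDual l A 1, - selfDual l A 0] B := by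
  obtain ⟨⟨h1, h2, h3, h4⟩, ⟨h5, h6, h7⟩, h8, h9, h10⟩ := skew_values hl
  have h := sqrt_two_inv_sq
  have hI := Complex.I_mul_I
  rw [selfDual_skew hl, selfDual_skew hl]
  fin_cases A <;> fin_cases B <;>
    simp [spinOf, Fin.sum_univ_four, solderUp_eq, solder_values, minkowski, h1, h2, h3, h4, h5, h6,
      h7, h8, h9, h10] <;> grind

/-- The derivation of the tensor algebra induced by a skew matrix acts on spinors through its
spin matrix. -/
theorem selfDual_action {l F : Fin 4 → Fin 4 → ℂ} (hl : ∀ a b, l a b + l b a = 0)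
    (hF : ∀ a b, F a b + F b a = 0) (A B : Fin 2) :
    selfDual (fun b c ↦ ∑ d, (minkowski d : ℂ) * (l b d * F d c + l c d * F b d)) A B =
      ∑ C, (spinOf l A C * selfDual F C B + spinOf l B C * selfDual F A C) := by
  -- The action preserves skewness, so the component formula `selfDual_skew` applies to the image as
  -- well.
  have hG (b c : Fin 4) : (∑ d, (minkowski d : ℂ) * (l b d * F d c + l c d * F b d)) +
      ∑ d, (minkowski d : ℂ) * (l c d * F d b + l b d * F c d) = 0 := by
    rw [← Finset.sum_add_distrib]
    exact Finset.sum_eq_zero fun d _ ↦ by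
      linear_combination (minkowski d : ℂ) * (l b d * hF d c + l c d * hF b d)
  obtain ⟨⟨h1, h2, h3, h4⟩, ⟨h5, h6, h7⟩, h8, h9, h10⟩ := skew_values hl
  obtain ⟨⟨k1, k2, k3, k4⟩, ⟨k5, k6, k7⟩, k8, k9, k10⟩ := skew_values hF
  have hI := Complex.I_mul_I
  simp only [selfDual_skew hG, spinOf_skew hl, selfDual_skew hl, selfDual_skew hF]
  fin_cases A <;> fin_cases B <;>
    simp [Fin.sum_univ_four, minkowski, h1, h2, h3, h4, h5, h6, h7, h8, h9, h10,
      k1, k2, k3, k4, k5, k6, k8, k9, k10] <;> ring_nf <;> simp only [Complex.I_sq] <;> ring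

/-- A self-dual two-form. -/
structure IsSelfDual (G : Fin 4 → Fin 4 → ℂ) : Prop where
  skew (a b : Fin 4) : G a b + G b a = 0
  dual₁ : G 2 3 = Complex.I * G 0 1
  dual₂ : G 1 3 = - Complex.I * G 0 2
  dual₃ : G 1 2 = Complex.I * G 0 3

/-- Contraction of a self-dual two-form with a vector. -/
theorem IsSelfDual.contract {G : Fin 4 → Fin 4 → ℂ} (hG : IsSelfDual G) (x : Fin 4 → ℂ)
    (A A' : Fin 2) :
    ∑ a, solder a A A' * ∑ d, (minkowski d : ℂ) * (x d * G d a) =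
      ∑ D, selfDual G A D * ∑ E, eps D E * ∑ a, solder a E A' * x a := by
  obtain ⟨⟨h1, h2, h3, h4⟩, ⟨h5, h6, h7⟩, h8, h9, h10⟩ := skew_values hG.skew
  have hI := Complex.I_mul_I
  simp only [selfDual_skew hG.skew]
  fin_cases A <;> fin_cases A' <;>
    simp [Fin.sum_univ_four, minkowski, eps, solder_values, hG.dual₁, hG.dual₂, hG.dual₃, h1, h2,
      h3, h4, h5, h6, h7, h8, h9, h10] <;> grind

/-- A closed self-dual two-form is divergence-free. -/
theorem divergence_selfDual {G : Fin 4 → Fin 4 → Fin 4 → ℂ} (hG : ∀ e, IsSelfDual (G e))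
    (hcyc : ∀ e c d, G e c d + G c d e + G d e c = 0) (A' B : Fin 2) :
    ∑ A, ∑ E, eps A E * ∑ e, solder e A A' * selfDual (G e) B E = 0 := by
  -- Closedness in dimension four has four independent components, one for each triple of indices.
  -- Self-duality rewrites them through G₀₁, G₀₂, G₀₃, where they combine into the four components
  -- of the divergence.
  have c1 := hcyc 1 2 3
  have c2 := hcyc 0 1 2
  have c3 := hcyc 0 1 3
  have c4 := hcyc 0 2 3
  have hs (e a b) : G e a b = - G e b a := by linear_combination (hG e).skew a b
  simp only [hs _ 3 1, hs _ 2 0, hs _ 3 0, (hG _).dual₁, (hG _).dual₂, (hG _).dual₃]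
    at c1 c2 c3 c4
  have hI := Complex.I_mul_I
  simp only [fun e ↦ selfDual_skew (hG e).skew]
  fin_cases A' <;> fin_cases B <;>
    simp [Fin.sum_univ_four, eps, solder_values, (hG _).dual₁, (hG _).dual₂, (hG _).dual₃] <;>
    grind

end SpinorAlgebra

/-! ### Algebra of Ricci-flat curvature tensors and symmetrization -/

section Weyl

/-- A tensor with the algebraic symmetries of a Ricci-flat curvature tensor. -/
structure IsWeyl (W : Fin 4 → Fin 4 → Fin 4 → Fin 4 → ℂ) : Prop where
  skew₁ (a b c d : Fin 4) : W a b c d + W b a c d = 0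
  skew₂ (a b c d : Fin 4) : W a b c d + W a b d c = 0
  cyclic (a b c d : Fin 4) : W a b c d + W a c d b + W a d b c = 0
  ricci (b d : Fin 4) : ∑ a, (minkowski a : ℂ) * W a b a d = 0

variable {W : Fin 4 → Fin 4 → Fin 4 → Fin 4 → ℂ}

/-- The classical argument: a signed sum of the cyclic identities starting from each of the four
indices leaves twice the difference of the two sides. -/
theorem IsWeyl.pair (hW : IsWeyl W) (a b c d : Fin 4) : W a b c d = W c d a b := by
  have s1 (a b c d) : W a b c d = - W b a c d := by linear_combination hW.skew₁ a b c d
  have s2 (a b c d) : W a b c d = - W a b d c := by linear_combination hW.skew₂ a b c d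
  have k1 := hW.cyclic a b c d
  have k2 := hW.cyclic b c d a
  have k3 := hW.cyclic c d a b
  have k4 := hW.cyclic d a b c
  rw [s2 a c d b, s1 a d b c] at k1
  rw [s2 b c d a, s1 b d a c, s2 d b a c, s1 b a c d] at k2
  rw [s1 c a b d, s2 a c b d, s1 c b d a, s2 b c d a] at k3
  rw [s1 d b c a, s1 d c a b, s1 b d c a, s2 d b c a] at k4
  linear_combination (1 / 2 : ℂ) * (k1 - k2 - k3 + k4 + hW.skew₂ d b c a + hW.skew₂ a c d b)

/-- Skewness and pair symmetry leave 21 components. The ten Ricci equations and the one remaining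
cyclic identity eliminate eleven of them, and the ten kept serve as coordinates. -/
theorem IsWeyl.relations (hW : IsWeyl W) :
    (W 2 3 2 3 = - W 0 1 0 1 ∧ W 1 3 1 3 = - W 0 2 0 2 ∧ W 1 2 1 2 = - W 0 3 0 3) ∧
    (W 1 3 2 3 = W 0 1 0 2 ∧ W 1 2 2 3 = - W 0 1 0 3 ∧ W 1 2 1 3 = W 0 2 0 3) ∧
    (W 0 2 2 3 = - W 0 1 1 3 ∧ W 0 3 2 3 = W 0 1 1 2 ∧ W 0 3 1 3 = - W 0 2 1 2) ∧
    W 0 3 0 3 = - W 0 1 0 1 - W 0 2 0 2 ∧ W 0 3 1 2 = W 0 2 1 3 - W 0 1 2 3 := by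
  have s1 (a b c d) : W a b c d = - W b a c d := by linear_combination hW.skew₁ a b c d
  have s2 (a b c d) : W a b c d = - W a b d c := by linear_combination hW.skew₂ a b c d
  have d1 (a c d) : W a a c d = 0 := by linear_combination (1 / 2 : ℂ) * hW.skew₁ a a c d
  have d2 (a b c) : W a b c c = 0 := by linear_combination (1 / 2 : ℂ) * hW.skew₂ a b c c
  have p := hW.pair
  have r := hW.ricci
  simp only [Fin.sum_univ_four, minkowski] at r
  have r00 := r 0 0; have r11 := r 1 1; have r22 := r 2 2; have r33 := r 3 3
  have r01 := r 0 1; have r02 := r 0 2; have r03 := r 0 3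
  have r12 := r 1 2; have r13 := r 1 3; have r23 := r 2 3
  have hb := hW.cyclic 0 1 2 3
  simp [d1, d2, s1 1 0, s1 2 0, s1 3 0, s1 2 1, s1 3 1, s1 3 2, s2 _ _ 1 0, s2 _ _ 2 0, s2 _ _ 3 0,
    s2 _ _ 2 1, s2 _ _ 3 1, s2 _ _ 3 2] at r00 r11 r22 r33 r01 r02 r03 r12 r13 r23 hb
  refine ⟨⟨?_, ?_, ?_⟩, ⟨?_, ?_, ?_⟩, ⟨?_, ?_, ?_⟩, ?_, ?_⟩ <;> grind

/-- For a Ricci-flat curvature tensor the left and right duals agree. Projecting the first index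
pair to its self-dual part therefore projects the second pair too. -/
theorem IsWeyl.isSelfDual (hW : IsWeyl W) (A B : Fin 2) :
    IsSelfDual fun c d ↦ selfDual (fun a b ↦ W a b c d) A B := by
  obtain ⟨⟨h1, h2, h3⟩, ⟨h4, h5, h6⟩, ⟨h7, h8, h9⟩, h10, h11⟩ := hW.relations
  have hI := Complex.I_mul_I
  have hs (c d) := selfDual_skew (fun a b ↦ hW.skew₁ a b c d) A B
  have p := hW.pair
  constructor
  · intro c d
    have s2 (a b) : W a b d c = - W a b c d := by linear_combination hW.skew₂ a b c d
    change selfDual (fun a b ↦ W a b c d) A B + selfDual (fun a b ↦ W a b d c) A B = 0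
    rw [hs, hs]
    simp only [s2]
    fin_cases A <;> fin_cases B <;> simp <;> ring
  all_goals
    simp only [hs]
    fin_cases A <;> fin_cases B <;> simp [h1, h2, h3, h4, h5, h6, h7, h8, h9, h10, h11,
      p 1 2 0, p 1 3 0, p 2 3 0, p 2 3 1, p 1 3 1 2] <;> grind

/-- The spinor of a curvature-like tensor. -/
def selfDual₂ (W : Fin 4 → Fin 4 → Fin 4 → Fin 4 → ℂ) (A B C D : Fin 2) : ℂ :=
  selfDual (fun c d ↦ selfDual (fun a b ↦ W a b c d) A B) C D

/-- The components of the Weyl spinor, by the number of indices equal to one. -/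
def weylComponent (W : Fin 4 → Fin 4 → Fin 4 → Fin 4 → ℂ) : ℕ → ℂ
  | 0 => selfDual₂ W 0 0 0 0
  | 1 => selfDual₂ W 0 0 0 1
  | 2 => selfDual₂ W 0 0 1 1
  | 3 => selfDual₂ W 0 1 1 1
  -- Four two-valued indices sum to at most four, so this branch stands for the value four.
  | _ => selfDual₂ W 1 1 1 1

/-- This is total symmetry: a function of two-valued indices is symmetric exactly when it depends
only on the number of ones. Beyond symmetry within each pair it needs pair exchange and the
vanishing of the trace, hence Ricci-flatness and the cyclic identity. -/
theorem IsWeyl.selfDual₂_eq (hW : IsWeyl W) (A B C D : Fin 2) :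
    selfDual₂ W A B C D = weylComponent W ((A : ℕ) + B + C + D) := by
  obtain ⟨⟨h1, h2, h3⟩, ⟨h4, h5, h6⟩, ⟨h7, h8, h9⟩, h10, h11⟩ := hW.relations
  have hI := Complex.I_mul_I
  have hs (A B c d) := selfDual_skew (fun a b ↦ hW.skew₁ a b c d) A B
  have p := hW.pair
  have e (A B C D) : selfDual₂ W A B C D = _ := selfDual_skew (hW.isSelfDual A B).skew C D
  simp only [(hW.isSelfDual _ _).dual₁, (hW.isSelfDual _ _).dual₂, (hW.isSelfDual _ _).dual₃,
    hs] at e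
  fin_cases A <;> fin_cases B <;> fin_cases C <;> fin_cases D <;>
    simp [weylComponent, e, p 1 2 0, p 1 3 0, p 2 3 0, h7, h8, h9, h10, h11] <;> grind

/-- The second spinor slot pair of a Weyl tensor can be contracted first. -/
theorem IsWeyl.selfDual₂_swap (hW : IsWeyl W) (A B C D : Fin 2) :
    selfDual (fun d a ↦ selfDual (fun b c ↦ W d a b c) A B) C D = selfDual₂ W A B C D := by
  simp only [selfDual₂, fun a b c d ↦ hW.pair c d a b]

/-- Permuting the slots does not change the sum of the indices, so the average is over equal terms.
-/
theorem symmetrize_of_sum {n : ℕ} (w : ℕ → ℂ) (T : (Fin n → Fin 2) → ℂ)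
    (hT : ∀ I, T I = w (∑ k, (I k : ℕ))) (I : Fin n → Fin 2) : symmetrize T I = T I := by
  have h (s : Equiv.Perm (Fin n)) : T (I ∘ s) = T I := by
    rw [hT, hT]
    exact congrArg w (Equiv.sum_comp s fun k ↦ (I k : ℕ))
  simp only [symmetrize, h, Finset.sum_const, Finset.card_univ, Fintype.card_perm,
    Fintype.card_fin, nsmul_eq_mul]
  have : (n.factorial : ℂ) ≠ 0 := by exact_mod_cast n.factorial_ne_zero
  field_simp

/-- Splitting off the image of 0 lets sums over small symmetric groups be written out explicitly. -/
theorem sum_perm_succ {n : ℕ} (f : Equiv.Perm (Fin (n + 1)) → ℂ) :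
    ∑ s, f s = ∑ k, ∑ t : Equiv.Perm (Fin n), f (Equiv.Perm.decomposeFin.symm (k, t)) := by
  rw [← Equiv.sum_comp Equiv.Perm.decomposeFin.symm, Fintype.sum_prod_type]

theorem symmetrize_two (T : (Fin 2 → Fin 2) → ℂ) (A B : Fin 2) :
    symmetrize T ![A, B] = (1 / 2) * (T ![A, B] + T ![B, A]) := by
  have hv (v : Fin 2 → Fin 2) : v = ![v 0, v 1] := by
    ext i; fin_cases i <;> rfl
  simp only [symmetrize, sum_perm_succ, Fin.sum_univ_two, Finset.univ_unique,
    Finset.sum_singleton]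
  rw [hv (_ ∘ _), hv (![A, B] ∘ (Equiv.Perm.decomposeFin.symm (1, _)))]
  simp

theorem symmetrize_three (T : (Fin 3 → Fin 2) → ℂ) (A B C : Fin 2) :
    symmetrize T ![A, B, C] = (1 / 6) * (T ![A, B, C] + T ![A, C, B] + T ![B, A, C] + T ![B, C, A]
      + T ![C, A, B] + T ![C, B, A]) := by
  have hv (s : Equiv.Perm (Fin 3)) : ![A, B, C] ∘ s =
      ![![A, B, C] (s 0), ![A, B, C] (s 1), ![A, B, C] (s 2)] := by
    ext i; fin_cases i <;> rfl
  have e1 : (1 : Fin 3) = Fin.succ 0 := rfl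
  have e2 : (2 : Fin 3) = Fin.succ 1 := rfl
  simp only [symmetrize, hv, e1, e2, sum_perm_succ, Fin.sum_univ_two, Fin.sum_univ_three,
    Finset.univ_unique, Finset.sum_singleton, Equiv.Perm.decomposeFin_symm_apply_zero,
    Equiv.Perm.decomposeFin_symm_apply_succ]
  simp [Equiv.swap_apply_def, Nat.factorial]
  ring

/-- By the symmetry of `f` the 24 permutations fall into three classes of eight, one for each way of
pairing the four slots. -/
theorem symmetrize_mul (f : Fin 2 → Fin 2 → ℂ) (hf : ∀ A B, f A B = f B A) (I : Fin 4 → Fin 2) :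
    symmetrize (fun J ↦ f (J 0) (J 1) * f (J 2) (J 3)) I = (1 / 3) * (f (I 0) (I 1) * f (I 2) (I 3)
      + f (I 0) (I 2) * f (I 1) (I 3) + f (I 0) (I 3) * f (I 1) (I 2)) := by
  have e1 : (1 : Fin 4) = Fin.succ 0 := rfl
  have e2 : (2 : Fin 4) = Fin.succ 1 := rfl
  have e3 : (3 : Fin 4) = Fin.succ 2 := rfl
  have e4 : (1 : Fin 3) = Fin.succ 0 := rfl
  have e5 : (2 : Fin 3) = Fin.succ 1 := rfl
  have o (A B) : (f (I A) (I B) = f (I B) (I A)) := hf _ _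
  simp only [symmetrize, Function.comp_apply, e1, e2, e3, e4, e5, sum_perm_succ,
    Fin.sum_univ_two, Fin.sum_univ_three, Fin.sum_univ_four, Finset.univ_unique,
    Finset.sum_singleton, Equiv.Perm.decomposeFin_symm_apply_zero,
    Equiv.Perm.decomposeFin_symm_apply_succ]
  simp [Equiv.swap_apply_def, Nat.factorial]
  rw [o 1 0, o 2 0, o 3 0, o 2 1, o 3 1, o 3 2]
  ring

end Weyl

/-! ### The pointwise identity and the Ernst form -/

section PointwiseIdentity

/-- The algebraic core of the divergence formula for the Mars-Simon spinor. -/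
theorem marsSimon_algebra (w : ℕ → ℂ) (f x : Fin 2 → Fin 2 → ℂ) (hf : ∀ A B, f A B = f B A) (s : ℂ)
    (df : Fin 2 → Fin 2 → Fin 2 → Fin 2 → ℂ) (ds : Fin 2 → Fin 2 → ℂ)
    (hdf : ∀ A A' B C, df A A' B C = ∑ D : Fin 2, w ((A : ℕ) + B + C + D) * x D A')
    (hds : ∀ A A', ds A A' = -4 * ∑ B, f A B * x B A')
    (S : (Fin 4 → Fin 2) → ℂ)
    (hS : ∀ I, S I = w (∑ k, (I k : ℕ)) + (12 / s) * ((1 / 3) * (f (I 0) (I 1) * f (I 2) (I 3)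
      + f (I 0) (I 2) * f (I 1) (I 3) + f (I 0) (I 3) * f (I 1) (I 2))))
    (A' B C D : Fin 2) :
    ∑ A, ∑ E, eps A E * ((12 / s) * ((1 / 3) *
        ((df A A' B C * f D E + f B C * df A A' D E) + (df A A' B D * f C E + f B D * df A A' C E)
          + (df A A' B E * f C D + f B E * df A A' C D)))
      - (12 / s ^ 2) * ds A A' * ((1 / 3) * (f B C * f D E + f B D * f C E + f B E * f C D))) =
    (12 / s) * ∑ A, x A A' * symmetrize (fun J : Fin 3 → Fin 2 ↦
      ∑ F, S ![F, A, J 1, J 2] * ∑ G, eps F G * f (J 0) G) ![B, C, D] := by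
  have h10 := hf 1 0
  have hi : 12 / s ^ 2 = 12 * (s⁻¹) ^ 2 := by rw [inv_pow, div_eq_mul_inv]
  have hj : 12 / s = 12 * s⁻¹ := div_eq_mul_inv _ _
  simp only [symmetrize_three, hS, hdf, hds, hi, hj]
  -- Both sides are polynomials in `s⁻¹`: the first-order terms are of type Ψφξ, the second-order
  -- ones of type φφφξ. With `s⁻¹` an indeterminate, each choice of B, C, D is a ring identity.
  generalize s⁻¹ = t
  clear hS hdf hds hi hj hf
  fin_cases B <;> fin_cases C <;> fin_cases D <;>
    simp [Fin.sum_univ_two, Fin.sum_univ_four, eps, h10] <;> ring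

variable {M : Type*} [TopologicalSpace M] [ChartedSpace (EuclideanSpace ℝ (Fin 4)) M]
  [IsManifold (𝓡 4) ∞ M] {g : LorentzMetric M} {U : Set M} {nabla : TangentConnection M}
  {e : Tetrad g U} {xi : Π p : M, TangentSpace (𝓡 4) p} {p : M}

theorem killingForm_skew (hxi : IsKilling g nabla xi) (A A' B B' : Fin 2) :
    killingForm nabla e xi A A' B B' p = - killingForm nabla e xi B B' A A' p := by
  rw [killingForm, killingForm, Finset.sum_comm, ← Finset.sum_neg_distrib]
  refine Finset.sum_congr rfl fun b _ ↦ ?_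
  rw [← Finset.sum_neg_distrib]
  refine Finset.sum_congr rfl fun a _ ↦ ?_
  have h := hxi.2 p (e.vec a p) (e.vec b p)
  have h' : (g.inner p (nabla xi p (e.vec a p)) (e.vec b p) : ℂ) +
    (g.inner p (nabla xi p (e.vec b p)) (e.vec a p) : ℂ) = 0 := by exact_mod_cast h
  linear_combination solder a A A' * solder b B B' * h'

theorem killingMatrix_skew (hxi : IsKilling g nabla xi) (a b : Fin 4) :
    (g.inner p (nabla xi p (e.vec a p)) (e.vec b p) : ℂ) +
      (g.inner p (nabla xi p (e.vec b p)) (e.vec a p) : ℂ) = 0 := by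
  exact_mod_cast hxi.2 p (e.vec a p) (e.vec b p)

/-- The contraction of a skew form over primed indices is already symmetric, so symmetrizing changes
nothing. -/
theorem phi_eq_selfDual (hxi : IsKilling g nabla xi) (A B : Fin 2) :
    phi nabla e xi A B p = selfDual (fun a b ↦
      (g.inner p (nabla xi p (e.vec a p)) (e.vec b p) : ℂ)) A B := by
  have h := selfDual_symm (killingMatrix_skew (e := e) (p := p) hxi) A B
  rw [phi, symmetrize_two]
  simp only [Matrix.cons_val_zero, Matrix.cons_val_one]
  change 1 / 2 * (selfDual _ A B + selfDual _ B A) = _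
  rw [← h]
  ring

theorem phi_eq_killingForm (hxi : IsKilling g nabla xi) (A B : Fin 2) :
    phi nabla e xi A B p =
      (1 / 2) * (killingForm nabla e xi A 0 B 1 p - killingForm nabla e xi A 1 B 0 p) := by
  rw [phi_eq_selfDual hxi, selfDual]
  simp [Fin.sum_univ_two, eps, killingForm]
  ring

/-- A two-form splits into a φ_{AB}ε_{A'B'} part and a part proportional to ε_{AB}. With the given
volume form, F ↦ F + iF* doubles the former and kills the latter. -/
theorem selfDualForm_eq (hxi : IsKilling g nabla xi) (A A' B B' : Fin 2) :
    selfDualForm nabla e xi A A' B B' p = 2 * (phi nabla e xi A B p * eps A' B') := by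
  have hk := killingForm_skew (p := p) (e := e) hxi
  have k1 := hk 0 0 0 0
  have k2 := hk 0 1 0 1
  have k3 := hk 1 0 1 0
  have k4 := hk 1 1 1 1
  have k5 := hk 0 1 0 0
  have k6 := hk 1 0 0 0
  have k7 := hk 1 1 0 0
  have k8 := hk 1 0 0 1
  have k9 := hk 1 1 0 1
  have k10 := hk 1 1 1 0
  have hI := Complex.I_mul_I
  rw [phi_eq_killingForm hxi, selfDualForm]
  fin_cases A <;> fin_cases A' <;> fin_cases B <;> fin_cases B' <;>
    simp [Fin.sum_univ_two, eps, volumeSpinor] <;> grind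

/-- The factor is 2·2, from the Ernst form and from `selfDualForm_eq`; the sign is that of
ε_{A'B'}ξ^{BB'} = −ξ^B{}_{A'}. -/
theorem ernstForm_eq (hxi : IsKilling g nabla xi) (A A' : Fin 2) :
    ernstForm nabla e xi A A' p =
      -4 * ∑ B, phi nabla e xi A B p * killingVecMixed e xi B A' p := by
  simp only [ernstForm, selfDualForm_eq hxi, killingVecUp, killingVecMixed]
  fin_cases A' <;> simp [Fin.sum_univ_two, eps] <;> ring

end PointwiseIdentity

/-! ### Smooth fields, Lie brackets and directional derivatives -/

section Fields

variable {M : Type*} [TopologicalSpace M] [ChartedSpace (EuclideanSpace ℝ (Fin 4)) M]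
  [IsManifold (𝓡 4) ∞ M]

/-- Over ℝ the order `minSmoothness ℝ n` is just `n`. This instance and the next provide the
regularity under which brackets are defined and satisfy the Jacobi identity. -/
instance : IsManifold (𝓡 4) (minSmoothness ℝ 2) M :=
  .of_le (n := ∞) (by
    rw [minSmoothness_of_isRCLikeNormedField]; exact ENat.LEInfty.out)

instance : IsManifold (𝓡 4) (minSmoothness ℝ 3) M :=
  .of_le (n := ∞) (by
    rw [minSmoothness_of_isRCLikeNormedField]; exact ENat.LEInfty.out)

/-- The vector field `X` is smooth at `p`. -/
abbrev SmoothFieldAt (X : Π p : M, TangentSpace (𝓡 4) p) (p : M) : Prop :=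
  ContMDiffAt (𝓡 4) ((𝓡 4).prod 𝓘(ℝ, EuclideanSpace ℝ (Fin 4))) ∞
    (fun q ↦ (⟨q, X q⟩ : TangentBundle (𝓡 4) M)) p

/-- The real function `f` is smooth at `p`. -/
abbrev SmoothFunAt (f : M → ℝ) (p : M) : Prop := ContMDiffAt (𝓡 4) 𝓘(ℝ, ℝ) ∞ f p

variable {V W X : Π p : M, TangentSpace (𝓡 4) p} {f : M → ℝ} {p : M}

theorem SmoothFieldAt.mdifferentiableAt (hX : SmoothFieldAt X p) :
    MDifferentiableAt (𝓡 4) ((𝓡 4).prod 𝓘(ℝ, EuclideanSpace ℝ (Fin 4)))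
      (fun q ↦ (⟨q, X q⟩ : TangentBundle (𝓡 4) M)) p :=
  ContMDiffAt.mdifferentiableAt hX (by simp)

omit [IsManifold (𝓡 4) ∞ M] in
theorem SmoothFunAt.mdifferentiableAt (hf : SmoothFunAt f p) :
    MDifferentiableAt (𝓡 4) 𝓘(ℝ, ℝ) f p :=
  ContMDiffAt.mdifferentiableAt hf (by simp)

theorem SmoothFieldAt.inner (g : LorentzMetric M) (hX : SmoothFieldAt X p)
    (hW : SmoothFieldAt W p) : SmoothFunAt (fun q ↦ g.inner q (X q) (W q)) p := by
  have : ContMDiffWithinAt (𝓡 4) ((𝓡 4).prod 𝓘(ℝ)) ∞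
      (fun m ↦ Bundle.TotalSpace.mk' ℝ (E := Bundle.Trivial M ℝ) m (g.inner m (X m) (W m)))
      Set.univ p := by
    apply ContMDiffWithinAt.clm_bundle_apply₂ (F₁ := EuclideanSpace ℝ (Fin 4))
      (F₂ := EuclideanSpace ℝ (Fin 4))
    · exact g.contMDiff.contMDiffAt.contMDiffWithinAt
    · exact hX.contMDiffWithinAt
    · exact hW.contMDiffWithinAt
  simp only [Bundle.contMDiffWithinAt_totalSpace] at this
  exact contMDiffWithinAt_univ.1 this.2

theorem SmoothFieldAt.smul (hf : SmoothFunAt f p) (hX : SmoothFieldAt X p) :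
    SmoothFieldAt (f • X) p := ContMDiffAt.smul_section hf hX

theorem SmoothFieldAt.sub (hW : SmoothFieldAt W p) (hX : SmoothFieldAt X p) :
    SmoothFieldAt (W - X) p := ContMDiffAt.sub_section hW hX

theorem SmoothFieldAt.mlieBracket (hV : SmoothFieldAt V p) (hW : SmoothFieldAt W p) :
    SmoothFieldAt (VectorField.mlieBracket (𝓡 4) V W) p := by
  have : IsManifold (𝓡 4) (((⊤ : ℕ∞) : WithTop ℕ∞) + 1) M := ‹IsManifold (𝓡 4) ∞ M›
  exact ContMDiffAt.mlieBracket_vectorField (m := ⊤) (n := ⊤) hV hW (by simp)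

/-- Derivative of a real function along a vector field. -/
def fieldDeriv (V : Π p : M, TangentSpace (𝓡 4) p) (f : M → ℝ) (q : M) : ℝ :=
  mvfderiv (𝓡 4) f q (V q)

theorem mlieBracket_smul_fieldDeriv (hf : SmoothFunAt f p) (hX : SmoothFieldAt X p) :
    VectorField.mlieBracket (𝓡 4) V (f • X) p =
      fieldDeriv V f p • X p + f p • VectorField.mlieBracket (𝓡 4) V X p :=
  VectorField.mlieBracket_smul_right hf.mdifferentiableAt hX.mdifferentiableAt

theorem eventually_mlieBracket_smul {U : Set M} (hU : IsOpen U) (hp : p ∈ U)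
    (hf : ∀ q ∈ U, SmoothFunAt f q) (hX : ∀ q ∈ U, SmoothFieldAt X q) :
    VectorField.mlieBracket (𝓡 4) V (f • X) =ᶠ[nhds p]
      fieldDeriv V f • X + f • VectorField.mlieBracket (𝓡 4) V X := by
  filter_upwards [hU.mem_nhds hp] with q hq
  exact mlieBracket_smul_fieldDeriv (hf q hq) (hX q hq)

/-- From [V, fX] = (Vf)X + f[V, X], pairing with X and dividing by g(X, X) expresses Vf through
brackets, which are smooth. The field X is auxiliary and only has to be non-null. -/
theorem SmoothFunAt.fieldDeriv (g : LorentzMetric M) {U : Set M} (hU : IsOpen U) (hp : p ∈ U)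
    (hf : ∀ q ∈ U, SmoothFunAt f q) (hX : ∀ q ∈ U, SmoothFieldAt X q)
    (hV : SmoothFieldAt V p) (hne : g.inner p (X p) (X p) ≠ 0) :
    SmoothFunAt (fieldDeriv V f) p := by
  have h := eventually_mlieBracket_smul (V := V) hU hp hf hX
  have h1 := hV.mlieBracket ((hX p hp).smul (hf p hp))
  have h2 := h1.sub ((hV.mlieBracket (hX p hp)).smul (hf p hp))
  have h3 := h2.inner g (hX p hp)
  have h4 := (hX p hp).inner g (hX p hp)
  have h5 : SmoothFunAt _ p := ContMDiffAt.mul h3 (ContMDiffAt.inv₀ h4 hne)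
  refine ContMDiffAt.congr_of_eventuallyEq h5 ?_
  filter_upwards [h, h4.continuousAt.eventually_ne hne] with q hq hq'
  simp [hq]
  field_simp

/-- The commutator of derivatives along vector fields is the derivative along the bracket. -/
theorem fieldDeriv_commutator {U : Set M} (hU : IsOpen U) (hp : p ∈ U)
    (hf : ∀ q ∈ U, SmoothFunAt f q) (hV : SmoothFieldAt V p)
    (hW : SmoothFieldAt W p) (hX : ∀ q ∈ U, SmoothFieldAt X q) (hne : X p ≠ 0)
    (hVf : SmoothFunAt (fieldDeriv V f) p) (hWf : SmoothFunAt (fieldDeriv W f) p) :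
    fieldDeriv V (fieldDeriv W f) p - fieldDeriv W (fieldDeriv V f) p =
      mvfderiv (𝓡 4) f p (VectorField.mlieBracket (𝓡 4) V W p) := by
  have hfp := hf p hp
  have hXp := hX p hp
  have two : minSmoothness ℝ 2 ≤ ∞ := by
    rw [minSmoothness_of_isRCLikeNormedField]; exact ENat.LEInfty.out
  -- Subtracting `f` times the Jacobi identity for V, W, X from the one for V, W, fX leaves (VWf −
  -- WVf − [V,W]f)X = 0, and X does not vanish at `p`.
  have J1 := VectorField.leibniz_identity_mlieBracket_apply (hV.of_le two) (hW.of_le two)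
    ((hXp.smul hfp).of_le two)
  have J2 := VectorField.leibniz_identity_mlieBracket_apply (hV.of_le two) (hW.of_le two)
    (hXp.of_le two)
  have key (V W : Π p : M, TangentSpace (𝓡 4) p) (hV : SmoothFieldAt V p) (hW : SmoothFieldAt W p)
      (hWf : SmoothFunAt (MarsSimon.fieldDeriv W f) p) :
      VectorField.mlieBracket (𝓡 4) V (VectorField.mlieBracket (𝓡 4) W (f • X)) p =
      fieldDeriv V (fieldDeriv W f) p • X p + fieldDeriv W f p • VectorField.mlieBracket (𝓡 4) V X p
      + (fieldDeriv V f p • VectorField.mlieBracket (𝓡 4) W X p +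
        f p • VectorField.mlieBracket (𝓡 4) V (VectorField.mlieBracket (𝓡 4) W X) p) := by
    rw [Filter.EventuallyEq.mlieBracket_vectorField_eq (V₁ := V) (V := V) Filter.EventuallyEq.rfl
      (eventually_mlieBracket_smul (V := W) hU hp hf hX),
      VectorField.mlieBracket_add_right (hXp.smul hWf).mdifferentiableAt
      ((hW.mlieBracket hXp).smul hfp).mdifferentiableAt, mlieBracket_smul_fieldDeriv hWf hXp,
      mlieBracket_smul_fieldDeriv hfp (hW.mlieBracket hXp)]
  rw [key V W hV hW hWf, key W V hW hV hVf, mlieBracket_smul_fieldDeriv hfp hXp, J2] at J1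
  have h0 : (fieldDeriv V (fieldDeriv W f) p - fieldDeriv W (fieldDeriv V f) p -
      fieldDeriv (VectorField.mlieBracket (𝓡 4) V W) f p) • X p = 0 := by
    rw [← sub_eq_zero] at J1
    rw [← J1]
    module
  have h1 := (smul_eq_zero.1 h0).resolve_right hne
  exact sub_eq_zero.1 h1

end Fields

/-! ### Connection and curvature in an orthonormal tetrad -/

section TetradGeometry

variable {M : Type*} [TopologicalSpace M] [ChartedSpace (EuclideanSpace ℝ (Fin 4)) M]
  [IsManifold (𝓡 4) ∞ M] {g : LorentzMetric M} {U : Set M} {nabla : TangentConnection M}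
  {xi : Π p : M, TangentSpace (𝓡 4) p} {p q : M}

theorem minkowski_mul_self (a : Fin 4) : minkowski a * minkowski a = 1 := by
  fin_cases a <;> simp [minkowski]

theorem Tetrad.smoothFieldAt (hU : IsOpen U) (e : Tetrad g U) (hq : q ∈ U) (a : Fin 4) :
    SmoothFieldAt (e.vec a) q := (e.contMDiffOn a).contMDiffAt (hU.mem_nhds hq)

/-- Expansion of a tangent vector in an orthonormal frame. -/
theorem Tetrad.expand (e : Tetrad g U) (hq : q ∈ U) (v : TangentSpace (𝓡 4) q) :
    v = ∑ a, (minkowski a * g.inner q v (e.vec a q)) • e.vec a q := by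
  have hin (c : Fin 4 → ℝ) (b : Fin 4) :
      g.inner q (∑ a, c a • e.vec a q) (e.vec b q) = c b * minkowski b := by
    simp only [map_sum, map_smul, sum_apply, smul_apply,
      e.orthonormal q hq, smul_eq_mul]
    rw [Finset.sum_eq_single b (fun a _ h ↦ by simp [h]) (by simp)]
    simp
  have hli : LinearIndependent ℝ fun a ↦ e.vec a q := by
    rw [Fintype.linearIndependent_iff]
    intro c hc b
    have h := hin c b
    rw [hc] at h
    have hz : c b * minkowski b = 0 := by rw [← h]; simp
    have := congrArg (· * minkowski b) hz
    simpa [mul_assoc, minkowski_mul_self] using this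
  have hcard : Fintype.card (Fin 4) = Module.finrank ℝ (TangentSpace (𝓡 4) q) := by
    change _ = Module.finrank ℝ (EuclideanSpace ℝ (Fin 4))
    simp
  have hspan := hli.span_eq_top_of_card_eq_finrank hcard
  obtain ⟨c, hc⟩ := (Submodule.mem_span_range_iff_exists_fun ℝ).1
    (hspan ▸ Submodule.mem_top : v ∈ Submodule.span ℝ (Set.range fun a ↦ e.vec a q))
  rw [← hc]
  refine Finset.sum_congr rfl fun a _ ↦ ?_
  rw [hin, mul_comm, mul_assoc, minkowski_mul_self, mul_one]

/-- Inner products are computed componentwise in an orthonormal frame. -/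
theorem Tetrad.inner_eq_sum (e : Tetrad g U) (hq : q ∈ U) (v w : TangentSpace (𝓡 4) q) :
    g.inner q v w = ∑ a, minkowski a * (g.inner q v (e.vec a q) * g.inner q w (e.vec a q)) := by
  conv_lhs => rw [e.expand hq v]
  simp only [map_sum, map_smul, sum_apply, smul_apply,
    smul_eq_mul, g.symm q (e.vec _ q) w, mul_assoc]

/-- The lowered connection coefficients `g(∇_{e_a} e_b, e_c)`. -/
def lowerConn (nabla : TangentConnection M) (e : Tetrad g U) (a b c : Fin 4) (q : M) : ℝ :=
  g.inner q (nabla (e.vec b) q (e.vec a q)) (e.vec c q)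

theorem lowerConn_skew (hnabla : IsLeviCivita g nabla) (hU : IsOpen U) (e : Tetrad g U)
    (hq : q ∈ U) (a b c : Fin 4) : lowerConn nabla e a b c q + lowerConn nabla e a c b q = 0 := by
  have h := connCoeff_skew hnabla hU e hq a b c
  simpa only [lowerConn, connCoeff, ← mul_assoc, minkowski_mul_self, one_mul] using h

theorem torsion_free (hnabla : IsLeviCivita g nabla) {X Y : Π p : M, TangentSpace (𝓡 4) p}
    (hX : SmoothFieldAt X q) (hY : SmoothFieldAt Y q) :
    nabla Y q (X q) - nabla X q (Y q) = VectorField.mlieBracket (𝓡 4) X Y q :=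
  (CovariantDerivative.torsion_eq_zero_iff nabla).1 hnabla.torsion_eq_zero hX.mdifferentiableAt
    hY.mdifferentiableAt

theorem inner_mlieBracket (hnabla : IsLeviCivita g nabla) (hU : IsOpen U) (e : Tetrad g U)
    (hq : q ∈ U) (a b c : Fin 4) :
    g.inner q (VectorField.mlieBracket (𝓡 4) (e.vec a) (e.vec b) q) (e.vec c q) =
      lowerConn nabla e a b c q - lowerConn nabla e b a c q := by
  rw [← torsion_free hnabla (e.smoothFieldAt hU hq a) (e.smoothFieldAt hU hq b), map_sub,
    sub_apply, lowerConn, lowerConn]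

/-- The Koszul formula: with c_{abc} = g([e_a, e_b], e_c), the coefficient is (c_{abc} − c_{bca} +
c_{cab})/2, and brackets of smooth fields are smooth. -/
theorem lowerConn_smooth (hnabla : IsLeviCivita g nabla) (hU : IsOpen U) (e : Tetrad g U)
    (hq : q ∈ U) (a b c : Fin 4) : SmoothFunAt (lowerConn nabla e a b c) q := by
  have hs (a b c) : SmoothFunAt (fun q ↦ g.inner q
      (VectorField.mlieBracket (𝓡 4) (e.vec a) (e.vec b) q) (e.vec c q)) q :=
    ((e.smoothFieldAt hU hq a).mlieBracket (e.smoothFieldAt hU hq b)).inner g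
      (e.smoothFieldAt hU hq c)
  have h : SmoothFunAt _ q := contMDiffAt_const (c := (1 / 2 : ℝ)) |>.mul
    (((hs a b c).sub (hs b c a)).add (hs c a b))
  refine h.congr_of_eventuallyEq ?_
  filter_upwards [hU.mem_nhds hq] with r hr
  simp only [Pi.mul_apply, Pi.add_apply, inner_mlieBracket hnabla hU e hr]
  have h1 := lowerConn_skew hnabla hU e hr a b c
  have h2 := lowerConn_skew hnabla hU e hr b a c
  have h3 := lowerConn_skew hnabla hU e hr c a b
  linear_combination (1 / 2) * (h1 + h2 - h3)

theorem nabla_smooth (hnabla : IsLeviCivita g nabla) (hU : IsOpen U) (e : Tetrad g U)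
    (hq : q ∈ U) (a b : Fin 4) : SmoothFieldAt (fun r ↦ nabla (e.vec b) r (e.vec a r)) q := by
  have h : SmoothFieldAt
      (fun r ↦ ∑ c, ((fun r ↦ minkowski c * lowerConn nabla e a b c r) • e.vec c) r) q :=
    ContMDiffAt.sum_section fun c _ ↦ SmoothFieldAt.smul
      (contMDiffAt_const.mul (lowerConn_smooth hnabla hU e hq a b c)) (e.smoothFieldAt hU hq c)
  refine ContMDiffAt.congr_of_eventuallyEq h ?_
  filter_upwards [hU.mem_nhds hq] with r hr
  congr 1
  exact e.expand hr _

theorem nabla_sub (X Y : Π p : M, TangentSpace (𝓡 4) p) (hX : SmoothFieldAt X q)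
    (hY : SmoothFieldAt Y q) : nabla (X - Y) q = nabla X q - nabla Y q := by
  have h := nabla.isCovariantDerivativeOnUniv.add (hX.sub hY).mdifferentiableAt hY.mdifferentiableAt
  rw [sub_add_cancel] at h
  exact eq_sub_of_add_eq h.symm

theorem nabla_congr {X Y : Π p : M, TangentSpace (𝓡 4) p} (hX : SmoothFieldAt X q)
    (hY : SmoothFieldAt Y q) (h : ∀ᶠ r in nhds q, X r = Y r) : nabla X q = nabla Y q :=
  nabla.isCovariantDerivativeOnUniv.congr_of_eventuallyEq hX.mdifferentiableAt hY.mdifferentiableAt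
    Filter.univ_mem h

/-- The Riemann tensor in terms of the connection coefficients. -/
theorem riemann_eq (hnabla : IsLeviCivita g nabla) (hU : IsOpen U) (e : Tetrad g U)
    (hq : q ∈ U) (a b c d : Fin 4) : riemann nabla e a b c d q =
      fieldDeriv (e.vec c) (lowerConn nabla e d b a) q -
      fieldDeriv (e.vec d) (lowerConn nabla e c b a) q + ∑ f, minkowski f *
      (lowerConn nabla e d b f q * lowerConn nabla e c f a q
      - lowerConn nabla e c b f q * lowerConn nabla e d f a q
      - (lowerConn nabla e c d f q - lowerConn nabla e d c f q) * lowerConn nabla e f b a q) := by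
  have key (c d : Fin 4) : g.inner q (e.vec a q)
      (nabla (fun q ↦ nabla (e.vec b) q (e.vec d q)) q (e.vec c q)) =
      fieldDeriv (e.vec c) (lowerConn nabla e d b a) q +
      ∑ f, minkowski f * (lowerConn nabla e d b f q * lowerConn nabla e c f a q) := by
    -- Metric compatibility takes the outer derivative outside the inner product. The correction
    -- g(∇_d e_b, ∇_c e_a), expanded in the frame, gives the quadratic terms up to one use of
    -- skewness.
    have h := hnabla.metric (fun q ↦ nabla (e.vec b) q (e.vec d q)) (e.vec a) q (e.vec c q)
      (nabla_smooth hnabla hU e hq d b).mdifferentiableAt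
      (e.smoothFieldAt hU hq a).mdifferentiableAt
    have h2 := e.inner_eq_sum hq (nabla (e.vec b) q (e.vec d q)) (nabla (e.vec a) q (e.vec c q))
    rw [h2] at h
    change fieldDeriv (e.vec c) (lowerConn nabla e d b a) q = _ at h
    rw [h, g.symm q (e.vec a q), add_assoc, ← Finset.sum_add_distrib]
    rw [Finset.sum_eq_zero, add_zero]
    intro f _
    have hs := lowerConn_skew hnabla hU e hq c f a
    change _ * (lowerConn nabla e d b f q * lowerConn nabla e c a f q) + _ = 0
    linear_combination minkowski f * lowerConn nabla e d b f q * hs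
  have hbr : g.inner q (e.vec a q)
      (nabla (e.vec b) q (VectorField.mlieBracket (𝓡 4) (e.vec c) (e.vec d) q)) =
      ∑ f, minkowski f * ((lowerConn nabla e c d f q - lowerConn nabla e d c f q) *
        lowerConn nabla e f b a q) := by
    conv_lhs => rw [e.expand hq (VectorField.mlieBracket (𝓡 4) (e.vec c) (e.vec d) q)]
    simp only [map_sum, map_smul, smul_eq_mul, inner_mlieBracket hnabla hU e hq, mul_assoc]
    refine Finset.sum_congr rfl fun f _ ↦ ?_
    rw [g.symm, ← lowerConn]
  rw [riemann, curvature, map_sub, map_sub, key, key, hbr]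
  simp only [mul_sub, Finset.sum_sub_distrib]
  ring

/-- The algebraic Bianchi identity. -/
theorem riemann_cyclic (hnabla : IsLeviCivita g nabla) (hU : IsOpen U) (e : Tetrad g U)
    (hq : q ∈ U) (a b c d : Fin 4) : riemann nabla e a b c d q + riemann nabla e a c d b q +
      riemann nabla e a d b c q = 0 := by
  have hs := fun a ↦ e.smoothFieldAt hU hq a
  have two : minSmoothness ℝ 2 ≤ ∞ := by
    rw [minSmoothness_of_isRCLikeNormedField]; exact ENat.LEInfty.out
  -- Vanishing torsion regroups the terms of the cyclic sum as ∇_z[x,y] − ∇_{[x,y]}z = [z,[x,y]], so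
  -- the sum is zero by the Jacobi identity.
  have hd (x y z : Fin 4) : nabla (fun q ↦ nabla (e.vec y) q (e.vec x q)) q (e.vec z q) -
      nabla (fun q ↦ nabla (e.vec x) q (e.vec y q)) q (e.vec z q) - nabla (e.vec z) q
      (VectorField.mlieBracket (𝓡 4) (e.vec x) (e.vec y) q) =
      VectorField.mlieBracket (𝓡 4) (e.vec z)
        (VectorField.mlieBracket (𝓡 4) (e.vec x) (e.vec y)) q := by
    have hb := (hs x).mlieBracket (hs y)
    rw [← torsion_free hnabla (hs z) hb, ← sub_apply,
      ← nabla_sub _ _ (nabla_smooth hnabla hU e hq x y) (nabla_smooth hnabla hU e hq y x),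
      nabla_congr ((nabla_smooth hnabla hU e hq x y).sub (nabla_smooth hnabla hU e hq y x)) hb]
    filter_upwards [hU.mem_nhds hq] with r hr
    exact torsion_free hnabla (e.smoothFieldAt hU hr x) (e.smoothFieldAt hU hr y)
  have J := VectorField.leibniz_identity_mlieBracket_apply ((hs b).of_le two) ((hs c).of_le two)
    ((hs d).of_le two)
  have h1 := hd c d b
  have h2 := hd b d c
  have h3 := hd b c d
  rw [VectorField.mlieBracket_swap_apply
    (V := VectorField.mlieBracket (𝓡 4) (e.vec b) (e.vec c))] at J
  simp only [riemann, ← map_add]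
  have : curvature nabla (e.vec c) (e.vec d) (e.vec b) q +
      curvature nabla (e.vec d) (e.vec b) (e.vec c) q +
      curvature nabla (e.vec b) (e.vec c) (e.vec d) q = 0 := by
    simp only [curvature]
    rw [VectorField.mlieBracket_swap_apply (V := e.vec d) (W := e.vec b), map_neg]
    rw [← h1, ← h2, ← h3, ← sub_eq_zero] at J
    rw [← J]
    module
  rw [this, map_zero]

/-- Metric compatibility applied to g(e_b, ξ); it presents ∇_aξ_b in the form of `frameCov₁`. -/
theorem killingForm_eq (hnabla : IsLeviCivita g nabla) (hU : IsOpen U) (e : Tetrad g U)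
    (hxi : IsKilling g nabla xi) (hq : q ∈ U) (a b : Fin 4) :
    g.inner q (nabla xi q (e.vec a q)) (e.vec b q) =
      fieldDeriv (e.vec a) (fun q ↦ g.inner q (e.vec b q) (xi q)) q -
      ∑ c, minkowski c * (lowerConn nabla e a b c q * g.inner q (e.vec c q) (xi q)) := by
  have h := hnabla.metric (e.vec b) xi q (e.vec a q) (e.smoothFieldAt hU hq b).mdifferentiableAt
    (SmoothFieldAt.mdifferentiableAt hxi.1.contMDiffAt)
  change fieldDeriv (e.vec a) (fun q ↦ g.inner q (e.vec b q) (xi q)) q = _ at h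
  rw [h, e.inner_eq_sum hq (nabla (e.vec b) q (e.vec a q)) (xi q), g.symm q (e.vec b q)]
  simp only [g.symm q (xi q), lowerConn]
  ring

end TetradGeometry

/-! ### The algebra of functions smooth on an open set and its frame derivations -/

section SmoothAlgebra

variable {M : Type*} [TopologicalSpace M] [ChartedSpace (EuclideanSpace ℝ (Fin 4)) M]
  [IsManifold (𝓡 4) ∞ M] {g : LorentzMetric M} {U : Set M} {nabla : TangentConnection M}
  {xi : Π p : M, TangentSpace (𝓡 4) p} {p q : M}

omit [IsManifold (𝓡 4) ∞ M] in
theorem fieldDeriv_congr {V : Π p : M, TangentSpace (𝓡 4) p} {f h : M → ℝ}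
    (hfh : f =ᶠ[nhds q] h) : fieldDeriv V f q = fieldDeriv V h q := by
  simp only [fieldDeriv, mvfderiv, ContinuousLinearMap.comp_apply, hfh.mfderiv_eq]
  rfl

/-- The algebra of real functions which are smooth on `U`. -/
def smoothAlgebra (M : Type*) [TopologicalSpace M] [ChartedSpace (EuclideanSpace ℝ (Fin 4)) M]
    (U : Set M) : Subalgebra ℝ (M → ℝ) where
  carrier := {f | ∀ q ∈ U, SmoothFunAt f q}
  mul_mem' hf hh q hq := ContMDiffAt.mul (hf q hq) (hh q hq)
  add_mem' hf hh q hq := ContMDiffAt.add (hf q hq) (hh q hq)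
  algebraMap_mem' _ _ _ := contMDiffAt_const

/-- A function smooth on `U`, extended by zero, as an element of the algebra. -/
def smoothExtend (hU : IsOpen U) (f : M → ℝ) (hf : ∀ q ∈ U, SmoothFunAt f q) :
    smoothAlgebra M U :=
  ⟨U.indicator f, fun q hq ↦ (hf q hq).congr_of_eventuallyEq (by
    filter_upwards [hU.mem_nhds hq] with r hr using Set.indicator_of_mem hr f)⟩

/-- Evaluation of a smooth function at a point. -/
def pointEval (U : Set M) (q : M) : smoothAlgebra M U →ₐ[ℝ] ℝ :=
  (Pi.evalAlgHom ℝ (fun _ : M ↦ ℝ) q).comp (smoothAlgebra M U).val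

-- Equality in the algebra is equality on all of `M`. For this reason geometric functions are
-- extended by zero, and identities between them have a second, trivial case outside `U`.
omit [IsManifold (𝓡 4) ∞ M] in
theorem smoothAlgebra_ext {f h : smoothAlgebra M U} (H : ∀ q, pointEval U q f = pointEval U q h) :
    f = h := Subtype.ext (funext H)

omit [IsManifold (𝓡 4) ∞ M] in
theorem pointEval_extend (hU : IsOpen U) (f : M → ℝ) (hf : ∀ q ∈ U, SmoothFunAt f q)
    (hq : q ∈ U) : pointEval U q (smoothExtend hU f hf) = f q := Set.indicator_of_mem hq f

omit [IsManifold (𝓡 4) ∞ M] in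
theorem pointEval_extend_of_notMem (hU : IsOpen U) (f : M → ℝ) (hf : ∀ q ∈ U, SmoothFunAt f q)
    (hq : q ∉ U) : pointEval U q (smoothExtend hU f hf) = 0 := Set.indicator_of_notMem hq f

/-- The unit timelike frame vector e₀ serves as the non-null auxiliary field. -/
theorem fieldDeriv_smooth (hU : IsOpen U) (e : Tetrad g U) (a : Fin 4) {f : M → ℝ}
    (hf : ∀ q ∈ U, SmoothFunAt f q) (q : M) (hq : q ∈ U) :
    SmoothFunAt (fieldDeriv (e.vec a) f) q :=
  SmoothFunAt.fieldDeriv g hU hq hf (fun r hr ↦ e.smoothFieldAt hU hr 0) (e.smoothFieldAt hU hq a)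
    (by rw [e.orthonormal q hq]; simp [minkowski])

/-- The derivation along a frame vector. -/
def frameDerivation (hU : IsOpen U) (e : Tetrad g U) (a : Fin 4) :
    Derivation ℝ (smoothAlgebra M U) (smoothAlgebra M U) :=
  Derivation.mk'
    { toFun f := smoothExtend hU (fieldDeriv (e.vec a) f) (fieldDeriv_smooth hU e a f.2)
      map_add' f h := by
        refine smoothAlgebra_ext fun q ↦ ?_
        rw [map_add]
        by_cases hq : q ∈ U
        · simp only [pointEval_extend hU _ _ hq, fieldDeriv, Subalgebra.coe_add]
          rw [mvfderiv_add (f.2 q hq).mdifferentiableAt (h.2 q hq).mdifferentiableAt]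
          rfl
        · simp [pointEval_extend_of_notMem hU _ _ hq]
      map_smul' c f := by
        refine smoothAlgebra_ext fun q ↦ ?_
        rw [map_smul]
        by_cases hq : q ∈ U
        · simp only [pointEval_extend hU _ _ hq, fieldDeriv]
          have h := mvfderiv_smul (a := fun _ : M ↦ c) (x := q) (I := 𝓡 4) mdifferentiableAt_const
            (f.2 q hq).mdifferentiableAt
          have h' := congrArg (fun l ↦ l (e.vec a q)) h
          simpa [mvfderiv_const] using! h'
        · simp [pointEval_extend_of_notMem hU _ _ hq] }
    (by
      intro f h
      refine smoothAlgebra_ext fun q ↦ ?_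
      simp only [LinearMap.coe_mk, AddHom.coe_mk, smul_eq_mul, map_add, map_mul]
      by_cases hq : q ∈ U
      · simp only [pointEval_extend hU _ _ hq, fieldDeriv]
        have H := mvfderiv_mul (f.2 q hq).mdifferentiableAt (h.2 q hq).mdifferentiableAt
        have H' := congrArg (fun l ↦ l (e.vec a q)) H
        simpa using! H'
      · simp [pointEval_extend_of_notMem hU _ _ hq])

theorem pointEval_frameDerivation (hU : IsOpen U) (e : Tetrad g U) (a : Fin 4)
    (f : smoothAlgebra M U) (hq : q ∈ U) :
    pointEval U q (frameDerivation hU e a f) = fieldDeriv (e.vec a) f q :=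
  pointEval_extend hU _ (fieldDeriv_smooth hU e a f.2) hq

theorem pointEval_frameDerivation_of_notMem (hU : IsOpen U) (e : Tetrad g U) (a : Fin 4)
    (f : smoothAlgebra M U) (hq : q ∉ U) : pointEval U q (frameDerivation hU e a f) = 0 :=
  pointEval_extend_of_notMem hU _ (fieldDeriv_smooth hU e a f.2) hq

theorem pointEval_frameDerivation_of_eqOn (hU : IsOpen U) (e : Tetrad g U) (a : Fin 4)
    {f : smoothAlgebra M U} {h : M → ℝ} (hfh : ∀ q ∈ U, pointEval U q f = h q) (hq : q ∈ U) :
    pointEval U q (frameDerivation hU e a f) = fieldDeriv (e.vec a) h q := by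
  rw [pointEval_frameDerivation hU e a f hq]
  refine fieldDeriv_congr ?_
  filter_upwards [hU.mem_nhds hq] with r hr using hfh r hr

/-- The lowered connection coefficients as elements of the algebra. -/
def connElement (hnabla : IsLeviCivita g nabla) (hU : IsOpen U) (e : Tetrad g U) (a b c : Fin 4) :
    smoothAlgebra M U :=
  smoothExtend hU (lowerConn nabla e a b c) fun _ hq ↦ lowerConn_smooth hnabla hU e hq a b c

theorem pointEval_connElement (hnabla : IsLeviCivita g nabla) (hU : IsOpen U) (e : Tetrad g U)
    (hq : q ∈ U) (a b c : Fin 4) :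
    pointEval U q (connElement hnabla hU e a b c) = lowerConn nabla e a b c q :=
  pointEval_extend hU _ _ hq

/-- The diagonal metric entries as elements of the algebra. -/
def etaElement (U : Set M) (a : Fin 4) : smoothAlgebra M U :=
  algebraMap ℝ (smoothAlgebra M U) (minkowski a)

omit [IsManifold (𝓡 4) ∞ M] in
theorem pointEval_etaElement (a : Fin 4) : pointEval U q (etaElement U a) = minkowski a := rfl

theorem connElement_skew (hnabla : IsLeviCivita g nabla) (hU : IsOpen U) (e : Tetrad g U)
    (a b c : Fin 4) : connElement hnabla hU e a b c + connElement hnabla hU e a c b = 0 := by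
  refine smoothAlgebra_ext fun q ↦ ?_
  rw [map_add, map_zero]
  by_cases hq : q ∈ U
  · simpa only [pointEval_connElement hnabla hU e hq] using lowerConn_skew hnabla hU e hq a b c
  · simp [connElement, pointEval_extend_of_notMem hU _ _ hq]

/-- Vanishing torsion gives [e_a, e_b] the frame components η_c(L_{abc} − L_{bac}), and derivations
along vector fields commute up to their bracket. This is the commutator hypothesis of the frame
identities. -/
theorem frameDerivation_commutator (hnabla : IsLeviCivita g nabla) (hU : IsOpen U)
    (e : Tetrad g U) (a b : Fin 4) (f : smoothAlgebra M U) :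
    frameDerivation hU e a (frameDerivation hU e b f) -
      frameDerivation hU e b (frameDerivation hU e a f) = ∑ c, etaElement U c *
        ((connElement hnabla hU e a b c - connElement hnabla hU e b a c) *
          frameDerivation hU e c f) := by
  refine smoothAlgebra_ext fun q ↦ ?_
  simp only [map_sub, map_sum, map_mul, pointEval_etaElement]
  by_cases hq : q ∈ U
  · have hD (a) (r) (hr : r ∈ U) := pointEval_frameDerivation hU e a f hr
    rw [pointEval_frameDerivation_of_eqOn hU e a (hD b) hq,
      pointEval_frameDerivation_of_eqOn hU e b (hD a) hq]
    simp only [pointEval_frameDerivation hU e _ _ hq, pointEval_connElement hnabla hU e hq]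
    have hne : e.vec 0 q ≠ 0 := by
      intro h
      have := e.orthonormal q hq 0 0
      simp [h, minkowski] at this
    rw [fieldDeriv_commutator hU hq f.2 (e.smoothFieldAt hU hq a) (e.smoothFieldAt hU hq b)
      (fun r hr ↦ e.smoothFieldAt hU hr 0) hne (fieldDeriv_smooth hU e a f.2 q hq)
      (fieldDeriv_smooth hU e b f.2 q hq),
      e.expand hq (VectorField.mlieBracket (𝓡 4) (e.vec a) (e.vec b) q)]
    simp only [map_sum, map_smul, smul_eq_mul, inner_mlieBracket hnabla hU e hq, fieldDeriv,
      mul_assoc]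
  · simp [pointEval_frameDerivation_of_notMem hU e _ _ hq]

/-- The curvature as an element of the algebra. -/
def curvElement (hnabla : IsLeviCivita g nabla) (hU : IsOpen U) (e : Tetrad g U) :
    Fin 4 → Fin 4 → Fin 4 → Fin 4 → smoothAlgebra M U :=
  frameCurvature (etaElement U) (fun a ↦ frameDerivation hU e a) (connElement hnabla hU e)

theorem pointEval_curvElement (hnabla : IsLeviCivita g nabla) (hU : IsOpen U) (e : Tetrad g U)
    (a b c d : Fin 4) (q : M) (hq : q ∈ U) :
    pointEval U q (curvElement hnabla hU e a b c d) = riemann nabla e a b c d q := by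
  have hD (a b c d) := pointEval_frameDerivation_of_eqOn hU e a
    (fun r hr ↦ pointEval_connElement hnabla hU e hr b c d) hq
  simp only [curvElement, frameCurvature, map_add, map_sub, map_sum, map_mul, hD,
    pointEval_etaElement, pointEval_connElement hnabla hU e hq, riemann_eq hnabla hU e hq]

theorem curvElement_zero (hnabla : IsLeviCivita g nabla) (hU : IsOpen U) (e : Tetrad g U)
    (a b c d : Fin 4) (q : M) (hq : q ∉ U) :
    pointEval U q (curvElement hnabla hU e a b c d) = 0 := by
  simp [curvElement, frameCurvature, pointEval_frameDerivation_of_notMem hU e _ _ hq, connElement,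
    pointEval_extend_of_notMem hU _ _ hq]

theorem curvElement_cyclic (hnabla : IsLeviCivita g nabla) (hU : IsOpen U) (e : Tetrad g U)
    (a b c d : Fin 4) : curvElement hnabla hU e a b c d + curvElement hnabla hU e a c d b +
      curvElement hnabla hU e a d b c = 0 := by
  refine smoothAlgebra_ext fun q ↦ ?_
  by_cases hq : q ∈ U
  · simpa only [map_add, map_zero, pointEval_curvElement hnabla hU e _ _ _ _ q hq] using
      riemann_cyclic hnabla hU e hq a b c d
  · simp [curvElement_zero hnabla hU e _ _ _ _ q hq]

/-- On `U` the component agrees with an element of the algebra, which is smooth there by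
construction. -/
theorem riemann_smooth (hnabla : IsLeviCivita g nabla) (hU : IsOpen U) (e : Tetrad g U)
    (hq : q ∈ U) (a b c d : Fin 4) : SmoothFunAt (riemann nabla e a b c d) q := by
  refine ((curvElement hnabla hU e a b c d).2 q hq).congr_of_eventuallyEq ?_
  filter_upwards [hU.mem_nhds hq] with r hr
  exact (pointEval_curvElement hnabla hU e a b c d r hr).symm

/-- Covariant derivatives `∇_h R_{abcd}` of the Riemann tensor in the frame. -/
def riemannDeriv (nabla : TangentConnection M) (e : Tetrad g U) (h a b c d : Fin 4) (q : M) : ℝ :=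
  fieldDeriv (e.vec h) (riemann nabla e a b c d) q - ∑ f, minkowski f *
    (lowerConn nabla e h a f q * riemann nabla e f b c d q +
    lowerConn nabla e h b f q * riemann nabla e a f c d q +
    lowerConn nabla e h c f q * riemann nabla e a b f d q +
    lowerConn nabla e h d f q * riemann nabla e a b c f q)

theorem pointEval_riemannDeriv (hnabla : IsLeviCivita g nabla) (hU : IsOpen U) (e : Tetrad g U)
    (hq : q ∈ U) (h a b c d : Fin 4) :
    pointEval U q (frameCov₄ (etaElement U) (fun a ↦ frameDerivation hU e a)
      (connElement hnabla hU e) (curvElement hnabla hU e) h a b c d) =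
      riemannDeriv nabla e h a b c d q := by
  have hD (h a b c d) := pointEval_frameDerivation_of_eqOn hU e h
    (pointEval_curvElement hnabla hU e a b c d) hq
  simp only [riemannDeriv, frameCov₄, map_add, map_sub, map_sum, map_mul, hD, pointEval_etaElement,
    pointEval_connElement hnabla hU e hq, pointEval_curvElement hnabla hU e _ _ _ _ q hq]

/-- The differential Bianchi identity. -/
theorem riemannDeriv_cyclic (hnabla : IsLeviCivita g nabla) (hU : IsOpen U) (e : Tetrad g U)
    (hq : q ∈ U) (h a b c d : Fin 4) : riemannDeriv nabla e h a b c d q +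
      riemannDeriv nabla e c a b d h q + riemannDeriv nabla e d a b h c q = 0 := by
  have H := frameCurvature_bianchi (eta := etaElement U) (D := frameDerivation hU e)
    (L := connElement hnabla hU e) (fun a b ↦ Derivation.map_algebraMap _ _)
    (connElement_skew hnabla hU e) (frameDerivation_commutator hnabla hU e)
    (curvElement_cyclic hnabla hU e) h a b c d
  simp only [← pointEval_riemannDeriv hnabla hU e hq, ← map_add, ← map_zero (pointEval U q)]
  exact congrArg _ H

end SmoothAlgebra

/-- Compatibility with the metric makes the curvature skew in its first pair of indices. -/
theorem frameCurvature_skew {R : Type*} [CommRing R] [Algebra ℝ R] {eta : Fin 4 → R}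
    {D : Fin 4 → Derivation ℝ R R} {L : Fin 4 → Fin 4 → Fin 4 → R}
    (hskew : ∀ a b c, L a b c + L a c b = 0) (a b c d : Fin 4) :
    frameCurvature eta (fun a ↦ D a) L a b c d +
      frameCurvature eta (fun a ↦ D a) L b a c d = 0 := by
  have h (x y) : D x (L y b a) + D x (L y a b) = 0 := by rw [← map_add, hskew, map_zero]
  have hs : ∑ f, eta f * (L d b f * L c f a - L c b f * L d f a -
      (L c d f - L d c f) * L f b a) + ∑ f, eta f * (L d a f * L c f b - L c a f * L d f b -
      (L c d f - L d c f) * L f a b) = 0 := by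
    rw [← Finset.sum_add_distrib]
    refine Finset.sum_eq_zero fun f _ ↦ ?_
    linear_combination eta f * (L d b f * hskew c f a - L c b f * hskew d f a +
      L d a f * hskew c f b - L c a f * hskew d f b - (L c d f - L d c f) * hskew f b a)
  simp only [frameCurvature]
  linear_combination h c d - h d c + hs

/-! ### Curvature skewness and the second derivative of a Killing field -/

section KillingField

variable {M : Type*} [TopologicalSpace M] [ChartedSpace (EuclideanSpace ℝ (Fin 4)) M]
  [IsManifold (𝓡 4) ∞ M] {g : LorentzMetric M} {U : Set M} {nabla : TangentConnection M}
  {xi : Π p : M, TangentSpace (𝓡 4) p} {p q : M}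

theorem riemann_skew₁ (hnabla : IsLeviCivita g nabla) (hU : IsOpen U) (e : Tetrad g U)
    (hq : q ∈ U) (a b c d : Fin 4) :
    riemann nabla e a b c d q + riemann nabla e b a c d q = 0 := by
  rw [← pointEval_curvElement hnabla hU e _ _ _ _ q hq,
    ← pointEval_curvElement hnabla hU e _ _ _ _ q hq, ← map_add, ← map_zero (pointEval U q)]
  exact congrArg _ (frameCurvature_skew (connElement_skew hnabla hU e) a b c d)

theorem riemann_skew₂ (e : Tetrad g U) (a b c d : Fin 4) :
    riemann nabla e a b c d q + riemann nabla e a b d c q = 0 := by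
  have h : curvature nabla (e.vec c) (e.vec d) (e.vec b) q +
      curvature nabla (e.vec d) (e.vec c) (e.vec b) q = 0 := by
    rw [curvature, curvature, VectorField.mlieBracket_swap_apply (V := e.vec d), map_neg]
    abel
  rw [riemann, riemann, ← map_add, h, map_zero]

/-- Frame components `∇_a ξ_b` of the Killing 2-form. -/
def killingComp (nabla : TangentConnection M) (e : Tetrad g U)
    (xi : Π p : M, TangentSpace (𝓡 4) p) (a b : Fin 4) (q : M) : ℝ :=
  g.inner q (nabla xi q (e.vec a q)) (e.vec b q)

/-- The covector components of a Killing field as elements of the algebra. -/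
def killingElement (hU : IsOpen U) (e : Tetrad g U) (hxi : IsKilling g nabla xi) (a : Fin 4) :
    smoothAlgebra M U :=
  smoothExtend hU (fun q ↦ g.inner q (e.vec a q) (xi q)) fun _ hq ↦
    (e.smoothFieldAt hU hq a).inner g hxi.1.contMDiffAt

theorem pointEval_frameCov₁_killing (hnabla : IsLeviCivita g nabla) (hU : IsOpen U)
    (e : Tetrad g U) (hxi : IsKilling g nabla xi) (a b : Fin 4) (q : M) (hq : q ∈ U) :
    pointEval U q (frameCov₁ (etaElement U) (fun a ↦ frameDerivation hU e a)
      (connElement hnabla hU e) (killingElement hU e hxi) a b) = killingComp nabla e xi a b q := by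
  have hX (c : Fin 4) (r : M) (hr : r ∈ U) : pointEval U r (killingElement hU e hxi c) =
      g.inner r (e.vec c r) (xi r) := pointEval_extend hU _ _ hr
  simp only [frameCov₁, map_sub, map_sum, map_mul, pointEval_etaElement, hX _ q hq,
    pointEval_connElement hnabla hU e hq, pointEval_frameDerivation_of_eqOn hU e a (hX b) hq,
    killingComp, killingForm_eq hnabla hU e hxi hq]

theorem killingComp_smooth (hnabla : IsLeviCivita g nabla) (hU : IsOpen U)
    (e : Tetrad g U) (hxi : IsKilling g nabla xi) (hq : q ∈ U) (a b : Fin 4) :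
    SmoothFunAt (killingComp nabla e xi a b) q := by
  refine ((frameCov₁ (etaElement U) (fun a ↦ frameDerivation hU e a)
    (connElement hnabla hU e) (killingElement hU e hxi) a b).2 q hq).congr_of_eventuallyEq ?_
  filter_upwards [hU.mem_nhds hq] with r hr
  exact (pointEval_frameCov₁_killing hnabla hU e hxi a b r hr).symm

/-- A Killing field satisfies `∇_a ∇_b ξ_c = R_{dabc} ξ^d`. -/
theorem killingComp_deriv (hnabla : IsLeviCivita g nabla) (hU : IsOpen U)
    (e : Tetrad g U) (hxi : IsKilling g nabla xi) (hq : q ∈ U) (a b c : Fin 4) :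
    fieldDeriv (e.vec a) (killingComp nabla e xi b c) q - ∑ f, minkowski f *
      (lowerConn nabla e a b f q * killingComp nabla e xi f c q +
        lowerConn nabla e a c f q * killingComp nabla e xi b f q) =
      ∑ d, minkowski d * (g.inner q (e.vec d q) (xi q) * riemann nabla e d a b c q) := by
  have hF := pointEval_frameCov₁_killing hnabla hU e hxi
  have H := frameCov₂_killing (eta := etaElement U) (D := frameDerivation hU e)
    (L := connElement hnabla hU e) (fun a b ↦ Derivation.map_algebraMap _ _)
    (connElement_skew hnabla hU e) (frameDerivation_commutator hnabla hU e)
    (curvElement_cyclic hnabla hU e) (frameCurvature_skew (connElement_skew hnabla hU e))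
    (killingElement hU e hxi) (fun a b ↦ ?_) a b c
  · have H' := congrArg (pointEval U q) H
    have hX (c : Fin 4) : pointEval U q (killingElement hU e hxi c) =
      g.inner q (e.vec c q) (xi q) := pointEval_extend hU _ _ hq
    rw [frameCov₂] at H'
    change _ = pointEval U q (∑ d, etaElement U d * (killingElement hU e hxi d *
      curvElement hnabla hU e d a b c)) at H'
    simpa only [map_sub, map_sum, map_mul, map_add, pointEval_etaElement, hX,
      pointEval_connElement hnabla hU e hq, hF _ _ q hq,
      pointEval_frameDerivation_of_eqOn hU e a (hF b c) hq,
      pointEval_curvElement hnabla hU e _ _ _ _ q hq] using H'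
  · refine smoothAlgebra_ext fun r ↦ ?_
    rw [map_add, map_zero]
    by_cases hr : r ∈ U
    · rw [hF a b r hr, hF b a r hr]
      exact hxi.2 r _ _
    · simp [frameCov₁, pointEval_frameDerivation_of_notMem hU e _ _ hr, killingElement,
        pointEval_extend_of_notMem hU _ _ hr]

end KillingField

/-! ### Symmetries inherited by the covariant derivative -/

section FrameSymmetries

variable {R : Type*} [CommRing R] [Algebra ℝ R] {eta : Fin 4 → R} {D : Fin 4 → Derivation ℝ R R}
  {L : Fin 4 → Fin 4 → Fin 4 → R} {T : Fin 4 → Fin 4 → Fin 4 → Fin 4 → R}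

/-- Covariant differentiation is linear and treats all four slots alike, so a linear symmetry under
permuting slots passes from T to ∇T. The next two results hold for the same reason. -/
theorem frameCov₄_skew₁ (hT : ∀ a b c d, T a b c d + T b a c d = 0) (e a b c d : Fin 4) :
    frameCov₄ eta (fun a ↦ D a) L T e a b c d + frameCov₄ eta (fun a ↦ D a) L T e b a c d = 0 := by
  have h : D e (T a b c d) + D e (T b a c d) = 0 := by rw [← map_add, hT, map_zero]
  rw [frameCov₄, frameCov₄, sub_add_sub_comm, h, zero_sub, ← Finset.sum_add_distrib, neg_eq_zero]
  refine Finset.sum_eq_zero fun f _ ↦ ?_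
  linear_combination eta f * (L e a f * hT f b c d + L e b f * hT a f c d + L e c f * hT a b f d +
    L e d f * hT a b c f)

theorem frameCov₄_skew₂ (hT : ∀ a b c d, T a b c d + T a b d c = 0) (e a b c d : Fin 4) :
    frameCov₄ eta (fun a ↦ D a) L T e a b c d + frameCov₄ eta (fun a ↦ D a) L T e a b d c = 0 := by
  have h : D e (T a b c d) + D e (T a b d c) = 0 := by rw [← map_add, hT, map_zero]
  rw [frameCov₄, frameCov₄, sub_add_sub_comm, h, zero_sub, ← Finset.sum_add_distrib, neg_eq_zero]
  refine Finset.sum_eq_zero fun f _ ↦ ?_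
  linear_combination eta f * (L e a f * hT f b c d + L e b f * hT a f c d + L e c f * hT a b f d +
    L e d f * hT a b c f)

theorem frameCov₄_cyclic (hT : ∀ a b c d, T a b c d + T a c d b + T a d b c = 0)
    (e a b c d : Fin 4) : frameCov₄ eta (fun a ↦ D a) L T e a b c d +
      frameCov₄ eta (fun a ↦ D a) L T e a c d b +
      frameCov₄ eta (fun a ↦ D a) L T e a d b c = 0 := by
  have h : D e (T a b c d) + D e (T a c d b) + D e (T a d b c) = 0 := by
    rw [← map_add, ← map_add, hT, map_zero]
  rw [frameCov₄, frameCov₄, frameCov₄, sub_add_sub_comm, sub_add_sub_comm, h, zero_sub,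
    ← Finset.sum_add_distrib, ← Finset.sum_add_distrib, neg_eq_zero]
  refine Finset.sum_eq_zero fun f _ ↦ ?_
  linear_combination eta f * (L e a f * hT f b c d + L e b f * hT a f c d + L e c f * hT a b f d +
    L e d f * hT a b c f)

/-- The metric entries are constants, and the two connection terms acting on the contracted indices
cancel by skewness. So the trace commutes with covariant differentiation. -/
theorem frameCov₄_ricci (heta : ∀ a b, D a (eta b) = 0) (hskew : ∀ a b c, L a b c + L a c b = 0)
    (hT : ∀ b d, ∑ a, eta a * T a b a d = 0) (e b d : Fin 4) :
    ∑ a, eta a * frameCov₄ eta (fun a ↦ D a) L T e a b a d = 0 := by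
  have h : ∑ a, eta a * D e (T a b a d) = 0 := by
    have := congrArg (D e) (hT b d)
    simpa [heta] using this
  have hb : ∑ a, ∑ f, eta a * (eta f * (L e b f * T a f a d)) = 0 := by
    rw [Finset.sum_comm]
    refine Finset.sum_eq_zero fun f _ ↦ ?_
    have := congrArg (eta f * L e b f * ·) (hT f d)
    rw [mul_zero, Finset.mul_sum] at this
    rw [← this]
    exact Finset.sum_congr rfl fun a _ ↦ by ring
  have hd : ∑ a, ∑ f, eta a * (eta f * (L e d f * T a b a f)) = 0 := by
    rw [Finset.sum_comm]
    refine Finset.sum_eq_zero fun f _ ↦ ?_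
    have := congrArg (eta f * L e d f * ·) (hT b f)
    rw [mul_zero, Finset.mul_sum] at this
    rw [← this]
    exact Finset.sum_congr rfl fun a _ ↦ by ring
  have hs : ∑ a, ∑ f, eta a * (eta f * (L e a f * T f b a d)) +
      ∑ a, ∑ f, eta a * (eta f * (L e a f * T a b f d)) = 0 := by
    rw [Finset.sum_comm, ← Finset.sum_add_distrib]
    refine Finset.sum_eq_zero fun f _ ↦ ?_
    rw [← Finset.sum_add_distrib]
    refine Finset.sum_eq_zero fun a _ ↦ ?_
    linear_combination eta a * eta f * T f b a d * hskew e a f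
  simp only [frameCov₄, mul_sub, Finset.sum_sub_distrib, h, mul_add, Finset.mul_sum,
    Finset.sum_add_distrib, hb, hd]
  linear_combination -hs

end FrameSymmetries

/-! ### The vacuum curvature and its spinor -/

section WeylTensor

variable {M : Type*} [TopologicalSpace M] [ChartedSpace (EuclideanSpace ℝ (Fin 4)) M]
  [IsManifold (𝓡 4) ∞ M] {g : LorentzMetric M} {U : Set M} {nabla : TangentConnection M}
  {xi : Π p : M, TangentSpace (𝓡 4) p} {p q : M}

theorem isWeyl_riemann (hnabla : IsLeviCivita g nabla) (hvac : IsVacuum g nabla) (hU : IsOpen U)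
    (e : Tetrad g U) (hq : q ∈ U) : IsWeyl fun a b c d ↦ (riemann nabla e a b c d q : ℂ) where
  skew₁ a b c d := by exact_mod_cast riemann_skew₁ hnabla hU e hq a b c d
  skew₂ a b c d := by exact_mod_cast riemann_skew₂ e a b c d
  cyclic a b c d := by exact_mod_cast riemann_cyclic hnabla hU e hq a b c d
  ricci b d := by exact_mod_cast hvac U hU e q hq b d

/-- The vacuum equations hold on all of the open set `U` and may be differentiated. Each directional
derivative is therefore itself Weyl-like, with self-dual contractions, as the divergence argument
requires. -/
theorem isWeyl_riemannDeriv (hnabla : IsLeviCivita g nabla) (hvac : IsVacuum g nabla)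
    (hU : IsOpen U) (e : Tetrad g U) (hq : q ∈ U) (h : Fin 4) :
    IsWeyl fun a b c d ↦ (riemannDeriv nabla e h a b c d q : ℂ) := by
  have hN := pointEval_riemannDeriv hnabla hU e hq
  have ext_of (f : smoothAlgebra M U) (hf : ∀ q ∈ U, pointEval U q f = 0)
      (hf' : ∀ q ∉ U, pointEval U q f = 0) : f = 0 :=
    smoothAlgebra_ext fun q ↦ by
      rw [map_zero]
      by_cases hq : q ∈ U
      exacts [hf q hq, hf' q hq]
  have hK := pointEval_curvElement hnabla hU e
  have hK' := curvElement_zero hnabla hU e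
  constructor
  · intro a b c d
    have := congrArg (pointEval U q) (frameCov₄_skew₁ (eta := etaElement U)
      (D := frameDerivation hU e) (L := connElement hnabla hU e) (T := curvElement hnabla hU e)
      (frameCurvature_skew (connElement_skew hnabla hU e)) h a b c d)
    rw [map_add, map_zero, hN, hN] at this
    exact_mod_cast this
  · intro a b c d
    have := congrArg (pointEval U q) (frameCov₄_skew₂ (eta := etaElement U)
      (D := frameDerivation hU e) (L := connElement hnabla hU e) (T := curvElement hnabla hU e)
      (fun a b c d ↦ ext_of _
        (fun q hq ↦ by rw [map_add, hK _ _ _ _ q hq, hK _ _ _ _ q hq, riemann_skew₂])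
        (fun q hq ↦ by simp [hK' _ _ _ _ q hq])) h a b c d)
    rw [map_add, map_zero, hN, hN] at this
    exact_mod_cast this
  · intro a b c d
    have := congrArg (pointEval U q) (frameCov₄_cyclic (eta := etaElement U)
      (D := frameDerivation hU e) (L := connElement hnabla hU e)
      (curvElement_cyclic hnabla hU e) h a b c d)
    rw [map_add, map_add, map_zero, hN, hN, hN] at this
    exact_mod_cast this
  · intro b d
    have := congrArg (pointEval U q) (frameCov₄_ricci (eta := etaElement U)
      (D := frameDerivation hU e) (L := connElement hnabla hU e) (T := curvElement hnabla hU e)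
      (fun a b ↦ Derivation.map_algebraMap _ _) (connElement_skew hnabla hU e)
      (fun b d ↦ ext_of _
        (fun q hq ↦ by
          simp only [map_sum, map_mul, hK _ _ _ _ q hq, pointEval_etaElement]
          exact hvac U hU e q hq b d)
        (fun q hq ↦ by simp [hK' _ _ _ _ q hq])) h b d)
    simp only [map_sum, map_mul, map_zero, hN, pointEval_etaElement] at this
    exact_mod_cast this

/-- The prefactor 1/4 splits into one 1/2 for each index pair; the rest is a reordering of finite
sums. -/
theorem curvatureSpinor_eq (e : Tetrad g U) (I : Fin 4 → Fin 2) : curvatureSpinor nabla e I q =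
    selfDual₂ (fun a b c d ↦ (riemann nabla e a b c d q : ℂ)) (I 0) (I 1) (I 2) (I 3) := by
  simp only [curvatureSpinor, riemannSpinor, selfDual₂, selfDual]
  generalize I 0 = A
  generalize I 1 = B
  generalize I 2 = C
  generalize I 3 = D
  let P (X Z : Fin 2) (c d : Fin 4) := ∑ a, ∑ b, solder a A X * solder b B Z *
    (riemann nabla e a b c d q : ℂ)
  have hP (X Z Y W : Fin 2) : ∑ a, ∑ b, ∑ c, ∑ d, solder a A X * solder b B Z * solder c C Y *
      solder d D W * (riemann nabla e a b c d q : ℂ) =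
      ∑ c, ∑ d, solder c C Y * solder d D W * P X Z c d := by
    simp only [P, Finset.mul_sum]
    rw [Finset.sum_congr rfl fun a _ ↦ Finset.sum_comm, Finset.sum_comm]
    refine Finset.sum_congr rfl fun c _ ↦ ?_
    rw [Finset.sum_congr rfl fun a _ ↦ Finset.sum_comm, Finset.sum_comm]
    refine Finset.sum_congr rfl fun d _ ↦ Finset.sum_congr rfl fun a _ ↦
      Finset.sum_congr rfl fun b _ ↦ by ring
  change _ = 1 / 2 * ∑ X', ∑ Y', eps X' Y' * ∑ c, ∑ d, solder c C X' * solder d D Y' *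
    (1 / 2 * ∑ X', ∑ Z', eps X' Z' * P X' Z' c d)
  simp only [hP]
  generalize P = P
  simp [Fin.sum_univ_two, Fin.sum_univ_four, eps]
  ring

theorem curvatureSpinor_eq_weylComponent (hnabla : IsLeviCivita g nabla) (hvac : IsVacuum g nabla)
    (hU : IsOpen U) (e : Tetrad g U) (hq : q ∈ U) (I : Fin 4 → Fin 2) :
    curvatureSpinor nabla e I q =
      weylComponent (fun a b c d ↦ (riemann nabla e a b c d q : ℂ)) (∑ k, (I k : ℕ)) := by
  rw [curvatureSpinor_eq, (isWeyl_riemann hnabla hvac hU e hq).selfDual₂_eq, Fin.sum_univ_four]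

/-- In vacuum the curvature spinor is already totally symmetric, so symmetrization leaves it
unchanged. -/
theorem weylSpinor_eq_weylComponent (hnabla : IsLeviCivita g nabla) (hvac : IsVacuum g nabla)
    (hU : IsOpen U) (e : Tetrad g U) (hq : q ∈ U) (I : Fin 4 → Fin 2) :
    weylSpinor nabla e I q =
      weylComponent (fun a b c d ↦ (riemann nabla e a b c d q : ℂ)) (∑ k, (I k : ℕ)) := by
  have h := curvatureSpinor_eq_weylComponent hnabla hvac hU e hq
  rw [weylSpinor, symmetrize_of_sum _ _ h, h]

theorem weylSpinor_eq (hnabla : IsLeviCivita g nabla) (hvac : IsVacuum g nabla)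
    (hU : IsOpen U) (e : Tetrad g U) (hq : q ∈ U) (I : Fin 4 → Fin 2) : weylSpinor nabla e I q =
    selfDual₂ (fun a b c d ↦ (riemann nabla e a b c d q : ℂ)) (I 0) (I 1) (I 2) (I 3) := by
  rw [weylSpinor_eq_weylComponent hnabla hvac hU e hq, ← curvatureSpinor_eq,
    curvatureSpinor_eq_weylComponent hnabla hvac hU e hq]

theorem spinCoeff_eq (e : Tetrad g U) (a : Fin 4) (A B : Fin 2) : spinCoeff nabla e a A B q =
    spinOf (fun b c ↦ (lowerConn nabla e a b c q : ℂ)) A B := by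
  simp [spinCoeff, spinOf, connCoeff, lowerConn]

end WeylTensor

/-! ### Rules for directional derivatives of complex functions -/

section DirectionalDerivatives

variable {M : Type*} [TopologicalSpace M] [ChartedSpace (EuclideanSpace ℝ (Fin 4)) M]

/-- The complex function `f` is differentiable at `q` with derivative `d` along `v`. -/
def HasDerivAlong (f : M → ℂ) (q : M) (v : TangentSpace (𝓡 4) q) (d : ℂ) : Prop :=
  ∃ f' : EuclideanSpace ℝ (Fin 4) →L[ℝ] ℂ, HasMFDerivAt (𝓡 4) 𝓘(ℝ, ℂ) f q f' ∧ f' v = d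

variable {f h : M → ℂ} {q : M} {v : TangentSpace (𝓡 4) q} {d d' : ℂ}

theorem HasDerivAlong.mdifferentiableAt (hf : HasDerivAlong f q v d) :
    MDifferentiableAt (𝓡 4) 𝓘(ℝ, ℂ) f q := by
  obtain ⟨f', hf', -⟩ := hf
  exact hf'.mdifferentiableAt

theorem HasDerivAlong.mvfderiv_eq (hf : HasDerivAlong f q v d) : mvfderiv (𝓡 4) f q v = d := by
  obtain ⟨f', hf', rfl⟩ := hf
  rw [mvfderiv, hf'.mfderiv]
  rfl

theorem MDifferentiableAt.hasDerivAlong (hf : MDifferentiableAt (𝓡 4) 𝓘(ℝ, ℂ) f q)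
    (v : TangentSpace (𝓡 4) q) : HasDerivAlong f q v (mvfderiv (𝓡 4) f q v) :=
  ⟨_, hf.hasMFDerivAt, rfl⟩

theorem HasDerivAlong.congr (hf : HasDerivAlong f q v d) (hfh : ∀ᶠ r in nhds q, h r = f r) :
    HasDerivAlong h q v d := by
  obtain ⟨f', hf', hd⟩ := hf
  exact ⟨f', hf'.congr_of_eventuallyEq hfh, hd⟩

theorem HasDerivAlong.add (hf : HasDerivAlong f q v d) (hh : HasDerivAlong h q v d') :
    HasDerivAlong (fun r ↦ f r + h r) q v (d + d') := by
  obtain ⟨f', hf', rfl⟩ := hf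
  obtain ⟨h', hh', rfl⟩ := hh
  exact ⟨_, hf'.add hh', rfl⟩

theorem HasDerivAlong.mul (hf : HasDerivAlong f q v d) (hh : HasDerivAlong h q v d') :
    HasDerivAlong (fun r ↦ f r * h r) q v (d * h q + f q * d') := by
  obtain ⟨f', hf', rfl⟩ := hf
  obtain ⟨h', hh', rfl⟩ := hh
  refine ⟨_, hf'.mul hh', ?_⟩
  change f q * h' v + h q * f' v = _
  ring

theorem HasDerivAlong.inv (hf : HasDerivAlong f q v d) (hq : f q ≠ 0) :
    HasDerivAlong (fun r ↦ (f r)⁻¹) q v (-(d / f q ^ 2)) := by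
  obtain ⟨f', hf', rfl⟩ := hf
  refine ⟨_, hf'.inv hq, ?_⟩
  change -(f q ^ 2)⁻¹ * f' v = _
  ring

theorem hasDerivAlong_const (c : ℂ) (q : M) (v : TangentSpace (𝓡 4) q) :
    HasDerivAlong (fun _ ↦ c) q v 0 := ⟨0, hasMFDerivAt_const c q, rfl⟩

theorem HasDerivAlong.const_mul (hf : HasDerivAlong f q v d) (c : ℂ) :
    HasDerivAlong (fun r ↦ c * f r) q v (c * d) := by
  simpa using (hasDerivAlong_const c q v).mul hf

theorem HasDerivAlong.sum {ι : Type*} {s : Finset ι} {f : ι → M → ℂ} {d : ι → ℂ}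
    (hf : ∀ i ∈ s, HasDerivAlong (f i) q v (d i)) :
    HasDerivAlong (fun r ↦ ∑ i ∈ s, f i r) q v (∑ i ∈ s, d i) := by
  classical
  induction s using Finset.induction_on with
  | empty => simpa using hasDerivAlong_const 0 q v
  | insert i s hi ih =>
    simp only [Finset.sum_insert hi]
    exact (hf i (s.mem_insert_self i)).add (ih fun j hj ↦ hf j (Finset.mem_insert_of_mem hj))

theorem SmoothFunAt.hasDerivAlong {f : M → ℝ} (hf : SmoothFunAt f q)
    (V : Π p : M, TangentSpace (𝓡 4) p) :
    HasDerivAlong (fun r ↦ (f r : ℂ)) q (V q) (MarsSimon.fieldDeriv V f q : ℂ) := by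
  have hc : HasMFDerivAt 𝓘(ℝ, ℝ) 𝓘(ℝ, ℂ) (fun x : ℝ ↦ (x : ℂ)) (f q) Complex.ofRealCLM :=
    Complex.ofRealCLM.hasMFDerivAt
  exact ⟨_, hc.comp q hf.mdifferentiableAt.hasMFDerivAt, rfl⟩

theorem HasDerivAlong.selfDual {F : Fin 4 → Fin 4 → M → ℂ} {dF : Fin 4 → Fin 4 → ℂ}
    (hF : ∀ a b, HasDerivAlong (F a b) q v (dF a b)) (A B : Fin 2) :
    HasDerivAlong (fun r ↦ MarsSimon.selfDual (fun a b ↦ F a b r) A B) q v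
      (MarsSimon.selfDual dF A B) :=
  (HasDerivAlong.sum fun _ _ ↦ HasDerivAlong.sum fun _ _ ↦ (HasDerivAlong.sum fun a _ ↦
    HasDerivAlong.sum fun b _ ↦ (hF a b).const_mul _).const_mul _).const_mul _

end DirectionalDerivatives

/-! ### Linearity and equivariance of the spinor map -/

section Linearity

theorem selfDual_add (F G : Fin 4 → Fin 4 → ℂ) (A B : Fin 2) :
    selfDual (fun a b ↦ F a b + G a b) A B = selfDual F A B + selfDual G A B := by
  simp only [selfDual, mul_add, Finset.sum_add_distrib]

theorem selfDual_const_mul (k : ℂ) (F : Fin 4 → Fin 4 → ℂ) (A B : Fin 2) :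
    selfDual (fun a b ↦ k * F a b) A B = k * selfDual F A B := by
  simp only [selfDual, Finset.mul_sum]
  refine Finset.sum_congr rfl fun X _ ↦ Finset.sum_congr rfl fun Y _ ↦
    Finset.sum_congr rfl fun a _ ↦ Finset.sum_congr rfl fun b _ ↦ by ring

theorem selfDual_sub (F G : Fin 4 → Fin 4 → ℂ) (A B : Fin 2) :
    selfDual (fun a b ↦ F a b - G a b) A B = selfDual F A B - selfDual G A B := by
  simp only [selfDual, mul_sub, Finset.sum_sub_distrib]

theorem selfDual_sum {ι : Type*} (s : Finset ι) (F : ι → Fin 4 → Fin 4 → ℂ) (A B : Fin 2) :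
    selfDual (fun a b ↦ ∑ i ∈ s, F i a b) A B = ∑ i ∈ s, selfDual (F i) A B := by
  classical
  induction s using Finset.induction_on with
  | empty => simp [selfDual]
  | insert i s hi ih => simp only [Finset.sum_insert hi, selfDual_add, ih]

/-- The derivation of the tensor algebra induced by a skew matrix acts on the spinor of a Weyl
tensor through its spin matrix. -/
theorem selfDual₂_action {l : Fin 4 → Fin 4 → ℂ} (hl : ∀ a b, l a b + l b a = 0)
    {W : Fin 4 → Fin 4 → Fin 4 → Fin 4 → ℂ} (hW : IsWeyl W) (A B C D : Fin 2) :
    selfDual₂ (fun a b c d ↦ ∑ f, (minkowski f : ℂ) * (l a f * W f b c d + l b f * W a f c d +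
      l c f * W a b f d + l d f * W a b c f)) A B C D =
      ∑ E, (spinOf l A E * selfDual₂ W E B C D + spinOf l B E * selfDual₂ W A E C D +
        spinOf l C E * selfDual₂ W A B E D + spinOf l D E * selfDual₂ W A B C E) := by
  have h1 (c d : Fin 4) := selfDual_action hl (fun a b ↦ hW.skew₁ a b c d) A B
  have h2 := selfDual_action hl (hW.isSelfDual A B).skew C D
  -- Equivariance is applied to the first index pair with `c`, `d` fixed, then by `h2` to the
  -- resulting self-dual form in the second pair.
  have hsplit (c d : Fin 4) : selfDual (fun a b ↦ ∑ f, (minkowski f : ℂ) * (l a f * W f b c d +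
      l b f * W a f c d + l c f * W a b f d + l d f * W a b c f)) A B =
      ∑ E, (spinOf l A E * selfDual (fun a b ↦ W a b c d) E B +
        spinOf l B E * selfDual (fun a b ↦ W a b c d) A E) +
      ∑ f, (minkowski f : ℂ) * (l c f * selfDual (fun a b ↦ W a b f d) A B +
        l d f * selfDual (fun a b ↦ W a b c f) A B) := by
    rw [← h1]
    simp only [add_assoc, mul_add, selfDual_add, selfDual_sum, selfDual_const_mul,
      Finset.sum_add_distrib]
  simp only [selfDual₂, hsplit]
  rw [selfDual_add, h2, selfDual_sum]
  simp only [selfDual_add, selfDual_const_mul]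
  rw [← Finset.sum_add_distrib]
  exact Finset.sum_congr rfl fun E _ ↦ by ring

end Linearity

/-! ### Covariant derivatives of the Weyl and Killing spinors -/

section SpinorDerivatives

variable {M : Type*} [TopologicalSpace M] [ChartedSpace (EuclideanSpace ℝ (Fin 4)) M]
  [IsManifold (𝓡 4) ∞ M] {g : LorentzMetric M} {U : Set M} {nabla : TangentConnection M}
  {xi : Π p : M, TangentSpace (𝓡 4) p} {p q : M}

/-- The covariant derivative of a spinor field along a frame vector. -/
def frameSpinDeriv (nabla : TangentConnection M) (e : Tetrad g U) {n : ℕ}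
    (T : (Fin n → Fin 2) → M → ℂ) (a : Fin 4) (I : Fin n → Fin 2) (q : M) : ℂ :=
  mvfderiv (𝓡 4) (T I) q (e.vec a q) -
    ∑ k, ∑ B, spinCoeff nabla e a (I k) B q * T (Function.update I k B) q

theorem covDeriv_eq (e : Tetrad g U) {n : ℕ} (T : (Fin n → Fin 2) → M → ℂ) (A A' : Fin 2)
    (I : Fin n → Fin 2) :
    covDeriv nabla e T A A' I q = ∑ a, solder a A A' * frameSpinDeriv nabla e T a I q := by
  simp only [covDeriv, gradient, frameSpinDeriv, mul_sub, Finset.sum_sub_distrib]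

theorem complex_lowerConn_skew (hnabla : IsLeviCivita g nabla) (hU : IsOpen U) (e : Tetrad g U)
    (hq : q ∈ U) (a b c : Fin 4) :
    (lowerConn nabla e a b c q : ℂ) + (lowerConn nabla e a c b q : ℂ) = 0 := by
  exact_mod_cast lowerConn_skew hnabla hU e hq a b c

theorem hasDerivAlong_weylSpinor (hnabla : IsLeviCivita g nabla) (hvac : IsVacuum g nabla)
    (hU : IsOpen U) (e : Tetrad g U) (hq : q ∈ U) (I : Fin 4 → Fin 2) (a : Fin 4) :
    HasDerivAlong (weylSpinor nabla e I) q (e.vec a q) (selfDual₂ (fun b c d f ↦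
      (fieldDeriv (e.vec a) (riemann nabla e b c d f) q : ℂ)) (I 0) (I 1) (I 2) (I 3)) := by
  refine HasDerivAlong.congr (HasDerivAlong.selfDual (fun c d ↦ HasDerivAlong.selfDual
    (fun a b ↦ (riemann_smooth hnabla hU e hq a b c d).hasDerivAlong (e.vec _)) _ _) _ _) ?_
  filter_upwards [hU.mem_nhds hq] with r hr using weylSpinor_eq hnabla hvac hU e hr I

/-- By `selfDual₂_action` the spin coefficients on the four spinor indices reproduce the connection
terms on the four tensor indices, so differentiation commutes with passing to spinors. -/
theorem frameSpinDeriv_weylSpinor (hnabla : IsLeviCivita g nabla) (hvac : IsVacuum g nabla)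
    (hU : IsOpen U) (e : Tetrad g U) (hq : q ∈ U) (I : Fin 4 → Fin 2) (a : Fin 4) :
    frameSpinDeriv nabla e (weylSpinor nabla e) a I q = selfDual₂ (fun b c d f ↦
      (riemannDeriv nabla e a b c d f q : ℂ)) (I 0) (I 1) (I 2) (I 3) := by
  have h := selfDual₂_action (complex_lowerConn_skew hnabla hU e hq a)
    (isWeyl_riemann hnabla hvac hU e hq) (I 0) (I 1) (I 2) (I 3)
  simp only [riemannDeriv, Complex.ofReal_sub, Complex.ofReal_sum, Complex.ofReal_mul,
    Complex.ofReal_add]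
  have hs : ∀ F G : Fin 4 → Fin 4 → Fin 4 → Fin 4 → ℂ, ∀ A B C D : Fin 2,
      selfDual₂ (fun a b c d ↦ F a b c d - G a b c d) A B C D =
        selfDual₂ F A B C D - selfDual₂ G A B C D := by
    intro F G A B C D
    simp only [selfDual₂, selfDual_sub]
  rw [hs, h, frameSpinDeriv, (hasDerivAlong_weylSpinor hnabla hvac hU e hq I a).mvfderiv_eq]
  simp only [spinCoeff_eq, weylSpinor_eq hnabla hvac hU e hq, Fin.sum_univ_four,
    Finset.sum_add_distrib]
  simp [Function.update]

/-- The spinor form of the Bianchi identity: the Weyl spinor is divergence-free. -/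
theorem covDeriv_weylSpinor (hnabla : IsLeviCivita g nabla) (hvac : IsVacuum g nabla)
    (hU : IsOpen U) (e : Tetrad g U) (hq : q ∈ U) (A' B C D : Fin 2) :
    ∑ A, ∑ E, eps A E * covDeriv nabla e (weylSpinor nabla e) A A' ![B, C, D, E] q = 0 := by
  simp only [covDeriv_eq, frameSpinDeriv_weylSpinor hnabla hvac hU e hq]
  -- With B and C fixed, the curvature derivative is a two-form in its last pair: self-dual by the
  -- vacuum equations, closed by the Bianchi identity.
  refine divergence_selfDual (G := fun h c d ↦ selfDual (fun a b ↦
    (riemannDeriv nabla e h a b c d q : ℂ)) B C)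
    (fun h ↦ (isWeyl_riemannDeriv hnabla hvac hU e hq h).isSelfDual B C) (fun h c d ↦ ?_) A' D
  simp only [← selfDual_add]
  have (a b : Fin 4) : (riemannDeriv nabla e h a b c d q : ℂ) +
      (riemannDeriv nabla e c a b d h q : ℂ) + (riemannDeriv nabla e d a b h c q : ℂ) = 0 := by
    exact_mod_cast riemannDeriv_cyclic hnabla hU e hq h a b c d
  simp only [this]
  simp [selfDual]

theorem phi_symm (hxi : IsKilling g nabla xi) (e : Tetrad g U) (A B : Fin 2) :
    phi nabla e xi A B q = phi nabla e xi B A q := by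
  rw [phi_eq_selfDual hxi, phi_eq_selfDual hxi, selfDual_symm (killingMatrix_skew hxi)]

theorem hasDerivAlong_phi (hnabla : IsLeviCivita g nabla) (hxi : IsKilling g nabla xi)
    (hU : IsOpen U) (e : Tetrad g U) (hq : q ∈ U) (A B : Fin 2) (a : Fin 4) :
    HasDerivAlong (phi nabla e xi A B) q (e.vec a q) (selfDual (fun b c ↦
      (fieldDeriv (e.vec a) (killingComp nabla e xi b c) q : ℂ)) A B) :=
  HasDerivAlong.congr (HasDerivAlong.selfDual (fun b c ↦
    (killingComp_smooth hnabla hU e hxi hq b c).hasDerivAlong (e.vec a)) A B)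
    (Filter.Eventually.of_forall fun _ ↦ phi_eq_selfDual hxi A B)

/-- The covariant derivative of the Killing spinor along a frame vector. -/
def phiDeriv (nabla : TangentConnection M) (e : Tetrad g U) (xi : Π p : M, TangentSpace (𝓡 4) p)
    (a : Fin 4) (A B : Fin 2) (q : M) : ℂ :=
  mvfderiv (𝓡 4) (phi nabla e xi A B) q (e.vec a q) -
    ∑ C, (spinCoeff nabla e a A C q * phi nabla e xi C B q +
      spinCoeff nabla e a B C q * phi nabla e xi A C q)

/-- Equivariance identifies ∇φ with the spinor of ∇F, and for a Killing field ∇F is the curvature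
contracted with ξ. -/
theorem phiDeriv_eq (hnabla : IsLeviCivita g nabla) (hxi : IsKilling g nabla xi)
    (hU : IsOpen U) (e : Tetrad g U) (hq : q ∈ U) (A B : Fin 2) (a : Fin 4) :
    phiDeriv nabla e xi a A B q = ∑ d, (minkowski d : ℂ) * ((g.inner q (e.vec d q) (xi q) : ℂ) *
      selfDual (fun b c ↦ (riemann nabla e d a b c q : ℂ)) A B) := by
  have h := selfDual_action (complex_lowerConn_skew hnabla hU e hq a)
    (killingMatrix_skew (e := e) (p := q) hxi) A B
  simp only [← phi_eq_selfDual hxi, ← spinCoeff_eq] at h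
  rw [phiDeriv, ← h, (hasDerivAlong_phi hnabla hxi hU e hq A B a).mvfderiv_eq, ← selfDual_sub]
  simp only [← selfDual_const_mul, ← selfDual_sum]
  congr 1
  ext b c
  have := killingComp_deriv hnabla hU e hxi hq a b c
  simp only [killingComp] at this
  exact_mod_cast this

/-- The derivative of the Killing spinor is the contraction of the Weyl spinor with the Killing
vector. -/
theorem solder_phiDeriv (hnabla : IsLeviCivita g nabla) (hvac : IsVacuum g nabla)
    (hxi : IsKilling g nabla xi) (hU : IsOpen U) (e : Tetrad g U) (hq : q ∈ U)
    (A A' B C : Fin 2) : ∑ a, solder a A A' * phiDeriv nabla e xi a B C q =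
      ∑ D : Fin 2, weylComponent (fun a b c d ↦ (riemann nabla e a b c d q : ℂ))
        ((A : ℕ) + B + C + D) * killingVecMixed e xi D A' q := by
  have hW := isWeyl_riemann hnabla hvac hU e hq
  have hG := hW.isSelfDual B C
  -- Here the spinor indices come from the last pair of R_{dabc}. Pair symmetry transfers
  -- self-duality to the first pair, which holds the Killing index and the derivative index.
  simp only [fun a b c d ↦ hW.pair c d a b] at hG
  simp only [phiDeriv_eq hnabla hxi hU e hq]
  rw [hG.contract fun d ↦ (g.inner q (e.vec d q) (xi q) : ℂ)]
  refine Finset.sum_congr rfl fun D _ ↦ ?_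
  rw [hW.selfDual₂_swap, hW.selfDual₂_eq, killingVecMixed]
  congr 2
  ring

end SpinorDerivatives

/-! ### The divergence of the Mars–Simon spinor -/

section MarsSimonSpinor

variable {M : Type*} [TopologicalSpace M] [ChartedSpace (EuclideanSpace ℝ (Fin 4)) M]
  [IsManifold (𝓡 4) ∞ M] {g : LorentzMetric M} {U : Set M} {nabla : TangentConnection M}
  {xi : Π p : M, TangentSpace (𝓡 4) p} {p q : M} {sigma : M → ℂ}

theorem marsSimonSpinor_eq (hxi : IsKilling g nabla xi) (e : Tetrad g U) (I : Fin 4 → Fin 2) :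
    marsSimonSpinor nabla e xi sigma I q = weylSpinor nabla e I q + 12 * ((sigma q)⁻¹ * ((1 / 3) *
      (phi nabla e xi (I 0) (I 1) q * phi nabla e xi (I 2) (I 3) q +
        phi nabla e xi (I 0) (I 2) q * phi nabla e xi (I 1) (I 3) q +
        phi nabla e xi (I 0) (I 3) q * phi nabla e xi (I 1) (I 2) q))) := by
  rw [marsSimonSpinor, symmetrize_mul (fun A B ↦ phi nabla e xi A B q) (phi_symm hxi e)]
  ring

theorem hasDerivAlong_marsSimonSpinor (hnabla : IsLeviCivita g nabla) (hvac : IsVacuum g nabla)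
    (hxi : IsKilling g nabla xi) (hU : IsOpen U) (e : Tetrad g U) (hq : q ∈ U)
    (hsigma : MDifferentiableAt (𝓡 4) 𝓘(ℝ, ℂ) sigma q) (hq0 : sigma q ≠ 0) (I : Fin 4 → Fin 2)
    (a : Fin 4) {dPsi ds : ℂ} {df : Fin 2 → Fin 2 → ℂ}
    (hPsi : dPsi = mvfderiv (𝓡 4) (weylSpinor nabla e I) q (e.vec a q))
    (hs : ds = mvfderiv (𝓡 4) sigma q (e.vec a q))
    (hf : ∀ A B, df A B = mvfderiv (𝓡 4) (phi nabla e xi A B) q (e.vec a q)) :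
    HasDerivAlong (marsSimonSpinor nabla e xi sigma I) q (e.vec a q)
      (dPsi + 12 * (-(ds / sigma q ^ 2) * ((1 / 3) *
      (phi nabla e xi (I 0) (I 1) q * phi nabla e xi (I 2) (I 3) q +
        phi nabla e xi (I 0) (I 2) q * phi nabla e xi (I 1) (I 3) q +
        phi nabla e xi (I 0) (I 3) q * phi nabla e xi (I 1) (I 2) q)) + (sigma q)⁻¹ * ((1 / 3) *
      ((df (I 0) (I 1) * phi nabla e xi (I 2) (I 3) q +
          phi nabla e xi (I 0) (I 1) q * df (I 2) (I 3)) +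
        (df (I 0) (I 2) * phi nabla e xi (I 1) (I 3) q +
          phi nabla e xi (I 0) (I 2) q * df (I 1) (I 3)) +
        (df (I 0) (I 3) * phi nabla e xi (I 1) (I 2) q +
          phi nabla e xi (I 0) (I 3) q * df (I 1) (I 2)))))) := by
  have hp (A B) : HasDerivAlong (phi nabla e xi A B) q (e.vec a q) (df A B) := by
    rw [hf]
    exact MDifferentiableAt.hasDerivAlong
      (hasDerivAlong_phi hnabla hxi hU e hq A B a).mdifferentiableAt _
  have hW : HasDerivAlong (weylSpinor nabla e I) q (e.vec a q) dPsi := by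
    rw [hPsi]
    exact MDifferentiableAt.hasDerivAlong
      (hasDerivAlong_weylSpinor hnabla hvac hU e hq I a).mdifferentiableAt _
  have hS : HasDerivAlong sigma q (e.vec a q) ds := hs ▸ MDifferentiableAt.hasDerivAlong hsigma _
  refine (hW.add (((hS.inv hq0).mul (((((hp _ _).mul (hp _ _)).add ((hp _ _).mul (hp _ _))).add
    ((hp _ _).mul (hp _ _))).const_mul (1 / 3))).const_mul 12)).congr
    (Filter.Eventually.of_forall fun r ↦ marsSimonSpinor_eq hxi e I)

/-- The Leibniz rule for the Mars-Simon spinor. -/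
theorem frameSpinDeriv_marsSimonSpinor (hnabla : IsLeviCivita g nabla) (hvac : IsVacuum g nabla)
    (hxi : IsKilling g nabla xi) (hU : IsOpen U) (e : Tetrad g U) (hq : q ∈ U)
    (hsigma : MDifferentiableAt (𝓡 4) 𝓘(ℝ, ℂ) sigma q) (hq0 : sigma q ≠ 0) (B C D E : Fin 2)
    (a : Fin 4) :
    frameSpinDeriv nabla e (marsSimonSpinor nabla e xi sigma) a ![B, C, D, E] q =
      frameSpinDeriv nabla e (weylSpinor nabla e) a ![B, C, D, E] q + ((12 / sigma q) * ((1 / 3) *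
        ((phiDeriv nabla e xi a B C q * phi nabla e xi D E q +
          phi nabla e xi B C q * phiDeriv nabla e xi a D E q) +
        (phiDeriv nabla e xi a B D q * phi nabla e xi C E q +
          phi nabla e xi B D q * phiDeriv nabla e xi a C E q) +
        (phiDeriv nabla e xi a B E q * phi nabla e xi C D q +
          phi nabla e xi B E q * phiDeriv nabla e xi a C D q))) -
      (12 / sigma q ^ 2) * mvfderiv (𝓡 4) sigma q (e.vec a q) * ((1 / 3) *
        (phi nabla e xi B C q * phi nabla e xi D E q + phi nabla e xi B D q * phi nabla e xi C E q
          + phi nabla e xi B E q * phi nabla e xi C D q))) := by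
  rw [frameSpinDeriv, (hasDerivAlong_marsSimonSpinor hnabla hvac hxi hU e hq hsigma hq0 _ a rfl rfl
    fun _ _ ↦ rfl).mvfderiv_eq]
  simp only [frameSpinDeriv, phiDeriv, marsSimonSpinor_eq hxi, Fin.sum_univ_four, Fin.sum_univ_two]
  simp [Function.update]
  ring

/-- The Weyl part contributes nothing by the Bianchi identity. The derivatives of φ and σ in the
quadratic part are algebraic in Ψ, φ and ξ, which reduces the claim to `marsSimon_algebra`. -/
theorem divergence_marsSimonSpinor (hnabla : IsLeviCivita g nabla) (hvac : IsVacuum g nabla)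
    (hxi : IsKilling g nabla xi) (hU : IsOpen U) (e : Tetrad g U) (hq : q ∈ U)
    (hsigma : IsErnstPotential nabla e xi sigma) (hq0 : sigma q ≠ 0) (A' B C D : Fin 2) :
    ∑ A, ∑ E, eps A E * covDeriv nabla e (marsSimonSpinor nabla e xi sigma) A A' ![B, C, D, E] q =
      (12 / sigma q) * ∑ A, killingVecMixed e xi A A' q *
        symmetrize (fun J : Fin 3 → Fin 2 ↦
          ∑ F, marsSimonSpinor nabla e xi sigma ![F, A, J 1, J 2] q *
            phiMixed nabla e xi (J 0) F q) ![B, C, D] := by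
  obtain ⟨hd, hgrad⟩ := hsigma q hq
  have key := marsSimon_algebra (weylComponent fun a b c d ↦ (riemann nabla e a b c d q : ℂ))
    (fun A B ↦ phi nabla e xi A B q) (fun A A' ↦ killingVecMixed e xi A A' q) (phi_symm hxi e)
    (sigma q) (fun A A' B C ↦ ∑ a, solder a A A' * phiDeriv nabla e xi a B C q)
    (fun A A' ↦ gradient e sigma A A' q) (solder_phiDeriv hnabla hvac hxi hU e hq)
    (fun A A' ↦ by rw [hgrad, ernstForm_eq hxi])
    (fun I ↦ marsSimonSpinor nabla e xi sigma I q)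
    (fun I ↦ by
      rw [marsSimonSpinor_eq hxi, weylSpinor_eq_weylComponent hnabla hvac hU e hq]
      ring) A' B C D
  simp only [phiMixed]
  -- A zero on the right is replaced by the vanishing divergence of Ψ, after which both sides match
  -- term by term under the sums over A and E.
  rw [← zero_add (12 / sigma q * _), ← covDeriv_weylSpinor hnabla hvac hU e hq A' B C D, ← key,
    ← Finset.sum_add_distrib]
  refine Finset.sum_congr rfl fun A _ ↦ ?_
  rw [← Finset.sum_add_distrib]
  refine Finset.sum_congr rfl fun E _ ↦ ?_
  simp only [covDeriv_eq, gradient,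
    frameSpinDeriv_marsSimonSpinor hnabla hvac hxi hU e hq hd hq0, Fin.sum_univ_four]
  ring

end MarsSimonSpinor

end MarsSimon

end

theorem mainTheorem2
    {M : Type*} [TopologicalSpace M] [ChartedSpace (EuclideanSpace ℝ (Fin 4)) M]
    [IsManifold (𝓡 4) ∞ M]
    (g : MarsSimon.LorentzMetric M) (nabla : MarsSimon.TangentConnection M)
    (hnabla : MarsSimon.IsLeviCivita g nabla)
    (hvac : MarsSimon.IsVacuum g nabla)
    (xi : Π p : M, TangentSpace (𝓡 4) p) (hxi : MarsSimon.IsKilling g nabla xi)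
    (U : Set M) (hU : IsOpen U) (e : MarsSimon.Tetrad g U)
    (sigma : M → ℂ) (hsigma : MarsSimon.IsErnstPotential nabla e xi sigma)
    (p : M) (hp : p ∈ U) (hp0 : sigma p ≠ 0) :
    (∀ I : Fin 4 → Fin 2, MDifferentiableAt (𝓡 4) 𝓘(ℝ, ℂ)
      (MarsSimon.marsSimonSpinor nabla e xi sigma I) p) ∧
    ∀ A' B C D : Fin 2,
      ∑ A, ∑ E, MarsSimon.eps A E *
          MarsSimon.covDeriv nabla e (MarsSimon.marsSimonSpinor nabla e xi sigma) A A'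
            ![B, C, D, E] p =
        (12 / sigma p) * ∑ A, MarsSimon.killingVecMixed e xi A A' p *
          MarsSimon.symmetrize (fun J : Fin 3 → Fin 2 ↦
            ∑ F, MarsSimon.marsSimonSpinor nabla e xi sigma ![F, A, J 1, J 2] p *
              MarsSimon.phiMixed nabla e xi (J 0) F p) ![B, C, D] := by
  -- Differentiability does not depend on a direction; the frame vector e₀ is an arbitrary choice.
  exact ⟨fun I ↦ (MarsSimon.hasDerivAlong_marsSimonSpinor hnabla hvac hxi hU e hp (hsigma p hp).1
    hp0 I 0 rfl rfl fun _ _ ↦ rfl).mdifferentiableAt,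
    MarsSimon.divergence_marsSimonSpinor hnabla hvac hxi hU e hp hsigma hp0⟩
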